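/- Let $P$ be a finite set of $n$ points in the plane, $n$ even, no three on a line. Its underlying graph joins two points of $P$ by a straight segment exactly when the line through them has equally many points of $P$ strictly on either side. A crossing is an unordered pair of distinct edges of this graph that meet in a point interior to both. An orientation is an angle $\theta$ such that, when the polar angle $\theta$ is turned up, no two points of $P$ lie on a common vertical line. Fix such a $\theta$. Each of the $n/2$ leftmost points $v$ of $P$ defines a chain: rotate the vertical line through $v$ clockwise; whenever it aligns itself with an edge of the underlying graph, put that edge in the chain and continue rotating about the rightmost vertex collected so far; terminate when the line becomes vertical again. A common upper tangent of two chains is a line through two distinct vertices, one from each chain, such that all other vertices of the two chains lie strictly below it. A pair of vertices $\{A,B\}$ is charged to a crossing $C$ of edges $e$ and $f$ if there are chains $S\ni e$ and $T\ni f$ and a common upper tangent of $S$ and $T$ through the vertices $A$ and $B$ such that the vertical line through the crossing point meets the segment $AB$. Then for every crossing $C$ and every orientation $\theta$ exactly one pair of vertices is charged to $C$; call it $f(C,\theta)$. Moreover, for any two distinct crossings $C_1,C_2$ and any orientations $\theta,\varphi$ (equal or different), $$f(C_1,\theta)\neq f(C_2,\varphi).$$ -/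

import Mathlib

namespace HalvingLines

/-- The Euclidean plane. -/
abbrev Plane : Type := EuclideanSpace ℝ (Fin 2)

/-- No three distinct points of `P` lie on a line. -/
def GeneralPosition (P : Finset Plane) : Prop :=
  ∀ a ∈ P, ∀ b ∈ P, ∀ c ∈ P, a ≠ b → a ≠ c → b ≠ c → ¬ Collinear ℝ {a, b, c}

/-- The determinant of `b - a` and `c - a`: positive if `c` lies to the left of the directed line
from `a` to `b`, negative if it lies to the right, zero if the three points are collinear. -/
def orient (a b c : Plane) : ℝ :=
  (b 0 - a 0) * (c 1 - a 1) - (b 1 - a 1) * (c 0 - a 0)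

theorem orient_swap (a b c : Plane) : orient b a c = - orient a b c := by
  unfold orient; ring

open Classical in
/-- The line through the two distinct points `a`, `b` of `P` has as many points of `P` strictly on
one side as strictly on the other side. -/
def IsHalving (P : Finset Plane) (a b : Plane) : Prop :=
  a ∈ P ∧ b ∈ P ∧ a ≠ b ∧
    (P.filter fun c => 0 < orient a b c).card = (P.filter fun c => orient a b c < 0).card

theorem IsHalving.symm {P : Finset Plane} {a b : Plane} (h : IsHalving P a b) :
    IsHalving P b a := by
  obtain ⟨ha, hb, hab, hc⟩ := h
  refine ⟨hb, ha, hab.symm, ?_⟩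
  simp only [orient_swap a b, Left.neg_pos_iff, Left.neg_neg_iff]
  exact hc.symm

/-- The underlying graph of `P`: two points are joined if the line through them is halving.
(Points of the plane outside `P` are isolated.) -/
def underlyingGraph (P : Finset Plane) : SimpleGraph Plane where
  Adj := IsHalving P
  symm := ⟨fun _ _ h => h.symm⟩
  loopless := ⟨fun _ h => h.2.2.1 rfl⟩

/-- Left-to-right coordinate when the plane is turned so that the polar angle `θ` points up. -/
noncomputable def xc (θ : ℝ) (p : Plane) : ℝ := p 0 * Real.sin θ - p 1 * Real.cos θ

/-- Height coordinate when the plane is turned so that the polar angle `θ` points up. -/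
noncomputable def yc (θ : ℝ) (p : Plane) : ℝ := p 0 * Real.cos θ + p 1 * Real.sin θ

/-- `θ` is an orientation for `P`: any two points of `P` have a definite left-to-right order,
that is, no two points of `P` lie on a common vertical line. -/
def IsOrientation (P : Finset Plane) (θ : ℝ) : Prop := Set.InjOn (xc θ) (P : Set Plane)

/-- Slope of the line through `a` and `b` when `θ` is up. A line rotating clockwise, from vertical
to vertical, runs through all slopes in decreasing order. -/
noncomputable def slopeAt (θ : ℝ) (a b : Plane) : ℝ := (yc θ b - yc θ a) / (xc θ b - xc θ a)

open Classical in
/-- `v` is among the `|P| / 2` leftmost points of `P`. -/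
def InLeftHalf (P : Finset Plane) (θ : ℝ) (v : Plane) : Prop :=
  v ∈ P ∧ 2 * (P.filter fun w => xc θ w < xc θ v).card < P.card

/-- A line rotating clockwise about `v`, starting from slope `m` (`⊤` is the vertical line), aligns
itself with the edge `vw` of the underlying graph before it aligns itself with any other edge and
before it becomes vertical. -/
def IsNextEdge (P : Finset Plane) (θ : ℝ) (v : Plane) (m : WithTop ℝ) (w : Plane) : Prop :=
  (underlyingGraph P).Adj v w ∧ (slopeAt θ v w : WithTop ℝ) < m ∧
    ∀ w', (underlyingGraph P).Adj v w' → (slopeAt θ v w' : WithTop ℝ) < m →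
      slopeAt θ v w' ≤ slopeAt θ v w

open Classical in
/-- The endpoint of the edge `vw` that is further to the right. -/
noncomputable def rightmost (θ : ℝ) (v w : Plane) : Plane := if xc θ v < xc θ w then w else v

/-- `Sweep P θ v m S`: the rotation process whose line currently passes through the pivot `v` with
slope `m` goes on to collect exactly the edges `S`, in this order, and terminates when the line
becomes vertical. Each time the line aligns itself with an edge, that edge is collected and the
rotation goes on about the rightmost vertex collected so far. -/
inductive Sweep (P : Finset Plane) (θ : ℝ) :
    Plane → WithTop ℝ → List (Sym2 Plane) → Prop
  | finish (v : Plane) (m : WithTop ℝ)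
      (h : ∀ w, (underlyingGraph P).Adj v w → ¬ (slopeAt θ v w : WithTop ℝ) < m) :
      Sweep P θ v m []
  | step (v w : Plane) (m : WithTop ℝ) (S : List (Sym2 Plane))
      (h : IsNextEdge P θ v m w)
      (hS : Sweep P θ (rightmost θ v w) (slopeAt θ v w : WithTop ℝ) S) :
      Sweep P θ v m (s(v, w) :: S)

/-- `S` is (the list of edges of) a chain of `P` when `θ` is up: it is collected by the rotation
process started from the vertical line through a point of the left half. -/
def IsChain (P : Finset Plane) (θ : ℝ) (S : List (Sym2 Plane)) : Prop :=
  ∃ v, InLeftHalf P θ v ∧ Sweep P θ v ⊤ S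

/-- The vertices of a chain. -/
def vertices (S : List (Sym2 Plane)) : Set Plane := {v | ∃ e ∈ S, v ∈ e}

/-- `v` lies strictly below the line through `a` and `b` when `θ` is up. -/
def StrictlyBelow (θ : ℝ) (a b v : Plane) : Prop :=
  yc θ v < yc θ a + slopeAt θ a b * (xc θ v - xc θ a)

/-- The line through the vertex `a` of `S` and the vertex `b` of `T` is a common upper tangent of
the chains `S` and `T`: the rest of the two chains lies strictly below it. -/
def IsCommonUpperTangent (θ : ℝ) (S T : List (Sym2 Plane)) (a b : Plane) : Prop :=
  a ∈ vertices S ∧ b ∈ vertices T ∧ a ≠ b ∧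
    ∀ v ∈ vertices S ∪ vertices T, v ≠ a → v ≠ b → StrictlyBelow θ a b v

/-- The relative interior of the segment that an unordered pair of points spans. -/
def edgeInterior (e : Sym2 Plane) : Set Plane :=
  {z | ∃ a b, e = s(a, b) ∧ z ∈ openSegment ℝ a b}

/-- A crossing: an unordered pair of distinct edges of the underlying graph (drawn as straight
segments) that meet in an interior point of both. -/
def IsCrossing (P : Finset Plane) (C : Sym2 (Sym2 Plane)) : Prop :=
  ∃ e f, C = s(e, f) ∧ e ≠ f ∧
    e ∈ (underlyingGraph P).edgeSet ∧ f ∈ (underlyingGraph P).edgeSet ∧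
    (edgeInterior e ∩ edgeInterior f).Nonempty

/-- When `θ` is up, the pair of vertices `p` forms a common upper tangent of the two chains that
cross at `C`, and the vertical line through the crossing point meets this tangent between the two
vertices. -/
def IsCharged (P : Finset Plane) (θ : ℝ) (C : Sym2 (Sym2 Plane)) (p : Sym2 Plane) : Prop :=
  ∃ (e f : Sym2 Plane) (S T : List (Sym2 Plane)) (a b z : Plane),
    C = s(e, f) ∧ p = s(a, b) ∧
    IsChain P θ S ∧ IsChain P θ T ∧ e ∈ S ∧ f ∈ T ∧
    z ∈ edgeInterior e ∩ edgeInterior f ∧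
    IsCommonUpperTangent θ S T a b ∧
    ∃ q ∈ segment ℝ a b, xc θ q = xc θ z

/-- The pair of vertices `f(C, θ)` that is charged to the crossing `C` when `θ` is up. -/
noncomputable def chargedPair (P : Finset Plane) (C : Sym2 (Sym2 Plane)) (θ : ℝ) : Sym2 Plane :=
  Classical.epsilon (IsCharged P θ C)

end HalvingLines

namespace HalvingLines

/-! A line rotating clockwise from the vertical about a point of the left half has fewer than half
of the points above it. As `P.card` is even, this can change only at a halving edge. Such an edge
must go to the right, and moving the pivot to its right endpoint restores the deficit
(`cnt_iff_of_gap`, `IsNextEdge.right`). So a chain is a concave path running rightwards. Reversing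
the rotation puts every halving edge in a chain (`exists_isChain`), and an edge determines the
vertices of its chain (`SweepsOut.range_eq`).

For a crossing, consider the upper hull of the vertices of both chains and its edge over the
crossing point. The crossing point is strictly below this edge, whereas a chord of a concave chain
stays below the chain; hence the hull edge has one end on each chain, and it is a common tangent.
Only one hull edge lies over a given abscissa.

For injectivity, consider one tangent charged to two crossings. In a single orientation the left
chain descends from the tangent and the right chain climbs back to it, so they cross only once below
it (`TangentOver.index_eq`). For two orientations, the upper side of the tangent is the one with
fewer points (`card_lt`), so they agree on which vertex is the left one. The halving edge met next,
clockwise about the left vertex or counterclockwise about the right one, depends on directions only.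
Hence the arcs leaving the left vertex agree as far as both run, and so do those arriving at the
right vertex (`p_add_eq`, `q_sub_eq`). The signed distance from the tangent, which is free of
orientation, rules out interleaved crossings (`not_interleaved`). Otherwise the crossing of one
orientation also occurs on the chains of the other, where a single crossing is known to exist. -/

/-! ### Determinants and slopes in a turned plane. -/

/-- The determinant of the vectors `b - a` and `d - c`. -/
def cross (a b c d : Plane) : ℝ :=
  (b 0 - a 0) * (d 1 - c 1) - (b 1 - a 1) * (d 0 - c 0)

theorem cross_eq (θ : ℝ) (a b c d : Plane) : cross a b c d =
    (xc θ b - xc θ a) * (yc θ d - yc θ c) - (yc θ b - yc θ a) * (xc θ d - xc θ c) := by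
  unfold cross xc yc
  linear_combination
    -((b 0 - a 0) * (d 1 - c 1) - (b 1 - a 1) * (d 0 - c 0)) * Real.sin_sq_add_cos_sq θ

theorem orient_eq_cross (a b c : Plane) : orient a b c = cross a b a c := rfl

theorem slopeAt_comm (θ : ℝ) (a b : Plane) : slopeAt θ a b = slopeAt θ b a := by
  unfold slopeAt
  rw [← neg_sub (yc θ a), ← neg_sub (xc θ a), neg_div_neg_eq]

theorem slopeAt_lt_iff {θ : ℝ} {a b c d : Plane} (h : xc θ a < xc θ b) (h' : xc θ c < xc θ d) :
    slopeAt θ c d < slopeAt θ a b ↔ cross a b c d < 0 := by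
  unfold slopeAt
  rw [div_lt_div_iff₀ (by linarith) (by linarith), cross_eq θ]
  constructor <;> intro h <;> nlinarith

/-- `c` lies above the line through `v` parallel to `ab`. -/
theorem cross_pos_iff {θ : ℝ} {a b v c : Plane} (h : xc θ a < xc θ b)
    (hc : c = v ∨ xc θ c ≠ xc θ v) : 0 < cross a b v c ↔
      (xc θ v < xc θ c ∧ slopeAt θ a b < slopeAt θ v c) ∨
      (xc θ c < xc θ v ∧ slopeAt θ v c < slopeAt θ a b) := by
  rcases hc with rfl | hc
  · simp [cross]
  rcases lt_or_gt_of_ne hc with hc | hc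
  · rw [slopeAt_comm θ v c, slopeAt_lt_iff h hc]
    simp only [hc, not_lt_of_gt hc, false_and, true_and, false_or]
    unfold cross
    constructor <;> intro h <;> linarith
  · rw [slopeAt_lt_iff hc h]
    simp only [hc, not_lt_of_gt hc, false_and, true_and, or_false]
    unfold cross
    constructor <;> intro h <;> linarith

theorem orient_ne_zero {P : Finset Plane} (hP : GeneralPosition P) {a b c : Plane}
    (ha : a ∈ P) (hb : b ∈ P) (hc : c ∈ P) (hab : a ≠ b) (hac : a ≠ c) (hbc : b ≠ c) :
    orient a b c ≠ 0 := by
  intro h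
  apply hP a ha b hb c hc hab hac hbc
  rw [collinear_iff_of_mem (p₀ := a) (by simp)]
  refine ⟨b - a, ?_⟩
  have key : ∃ r : ℝ, c = r • (b - a) + a := by
    unfold orient at h
    by_cases h0 : b 0 = a 0
    · have h1 : b 1 - a 1 ≠ 0 := by
        intro h1
        apply hab
        ext i
        fin_cases i
        · exact h0.symm
        · exact (sub_eq_zero.1 h1).symm
      refine ⟨(c 1 - a 1) / (b 1 - a 1), ?_⟩
      have h2 : c 0 - a 0 = 0 := by
        have : (b 1 - a 1) * (c 0 - a 0) = 0 := by rw [h0] at h; linarith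
        exact (mul_eq_zero.1 this).resolve_left h1
      ext i
      fin_cases i
      · simp [h0]; linarith
      · simp [h1]
    · have h1 : b 0 - a 0 ≠ 0 := sub_ne_zero.2 h0
      refine ⟨(c 0 - a 0) / (b 0 - a 0), ?_⟩
      ext i
      fin_cases i
      · simp [h1]
      · simp
        field_simp
        linarith
  simp only [Set.mem_insert_iff, Set.mem_singleton_iff, vadd_eq_add]
  rintro p (rfl | rfl | rfl)
  · exact ⟨0, by simp⟩
  · exact ⟨1, by simp⟩
  · exact key

open Classical in
theorem card_pos_add_card_neg {P : Finset Plane} (hP : GeneralPosition P) {a b : Plane}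
    (ha : a ∈ P) (hb : b ∈ P) (hab : a ≠ b) :
    (P.filter fun c => 0 < orient a b c).card + (P.filter fun c => orient a b c < 0).card + 2
      = P.card := by
  have h1 := Finset.card_filter_add_card_filter_not (s := P) (fun c => 0 < orient a b c)
  have h2 := Finset.card_filter_add_card_filter_not
    (s := P.filter fun c => ¬ 0 < orient a b c) (fun c => orient a b c < 0)
  rw [Finset.filter_filter, Finset.filter_filter] at h2
  have h3 : (P.filter fun c => ¬ 0 < orient a b c ∧ orient a b c < 0) =
      P.filter fun c => orient a b c < 0 := by
    apply Finset.filter_congr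
    intro c _
    constructor
    · exact fun h => h.2
    · exact fun h => ⟨not_lt_of_gt h, h⟩
  have h4 : (P.filter fun c => ¬ 0 < orient a b c ∧ ¬ orient a b c < 0) = {a, b} := by
    ext c
    simp only [Finset.mem_filter, Finset.mem_insert, Finset.mem_singleton]
    constructor
    · rintro ⟨hc, h5, h6⟩
      by_contra! h
      exact orient_ne_zero hP ha hb hc hab h.1.symm h.2.symm
        (le_antisymm (not_lt.1 h5) (not_lt.1 h6))
    · rintro (rfl | rfl)
      · refine ⟨ha, ?_⟩
        simp [orient]
      · refine ⟨hb, ?_⟩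
        simp [orient, mul_comm]
  rw [h3, h4, Finset.card_pair hab] at h2
  omega

/-! ### Counting the points above a rotating line. -/

open Classical in
/-- The number of points of `P` above the line through `v` that has just been rotated clockwise
past the slope `m`. -/
noncomputable def cntAfter (P : Finset Plane) (θ : ℝ) (v : Plane) (m : WithTop ℝ) : ℕ :=
  (P.filter fun w => (xc θ v < xc θ w ∧ m ≤ (slopeAt θ v w : WithTop ℝ)) ∨
    (xc θ w < xc θ v ∧ (slopeAt θ v w : WithTop ℝ) < m)).card

open Classical in
/-- The number of points of `P` above the line through `v` that is about to be rotated clockwise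
past the slope `m`. -/
noncomputable def cntBefore (P : Finset Plane) (θ : ℝ) (v : Plane) (m : ℝ) : ℕ :=
  (P.filter fun w => (xc θ v < xc θ w ∧ m < slopeAt θ v w) ∨
    (xc θ w < xc θ v ∧ slopeAt θ v w ≤ m)).card

theorem IsOrientation.ne {P : Finset Plane} {θ : ℝ} (hθ : IsOrientation P θ) {a b : Plane}
    (ha : a ∈ P) (hb : b ∈ P) (h : a ≠ b) : xc θ a ≠ xc θ b :=
  fun h' => h (hθ ha hb h')

theorem slopeAt_ne {P : Finset Plane} {θ : ℝ} (hP : GeneralPosition P) (hθ : IsOrientation P θ)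
    {v a b : Plane} (hv : v ∈ P) (ha : a ∈ P) (hb : b ∈ P) (hva : v ≠ a) (hvb : v ≠ b)
    (hab : a ≠ b) : slopeAt θ v a ≠ slopeAt θ v b := by
  intro h
  apply orient_ne_zero hP hv ha hb hva hvb hab
  have h1 := sub_ne_zero.2 (hθ.ne hv ha hva).symm
  have h2 := sub_ne_zero.2 (hθ.ne hv hb hvb).symm
  unfold slopeAt at h
  rw [div_eq_div_iff h1 h2] at h
  rw [orient_eq_cross, cross_eq θ]
  linarith

-- A point `w` on the right is still below the line before the pass, and one on the left is no
-- longer above it after the pass. These are the moments at which the count sees only points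
-- strictly beside the line `vw`.
open Classical in
theorem cntBefore_of_right {P : Finset Plane} {θ : ℝ} (hP : GeneralPosition P)
    (hθ : IsOrientation P θ) {v w : Plane} (hv : v ∈ P) (hw : w ∈ P) (h : xc θ v < xc θ w) :
    cntBefore P θ v (slopeAt θ v w) = (P.filter fun c => 0 < orient v w c).card := by
  have hvw : v ≠ w := by rintro rfl; exact lt_irrefl _ h
  unfold cntBefore
  congr 1
  apply Finset.filter_congr
  intro c hc
  by_cases hcv : c = v
  · subst hcv; simp [orient]
  rw [orient_eq_cross, cross_pos_iff h (Or.inr (hθ.ne hc hv hcv))]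
  refine or_congr Iff.rfl (and_congr_right fun h1 => ⟨fun h2 => lt_of_le_of_ne h2 ?_, le_of_lt⟩)
  apply slopeAt_ne hP hθ hv hc hw (Ne.symm hcv) hvw
  rintro rfl
  exact lt_asymm h h1

open Classical in
theorem cntAfter_of_left {P : Finset Plane} {θ : ℝ} (hP : GeneralPosition P)
    (hθ : IsOrientation P θ) {v w : Plane} (hv : v ∈ P) (hw : w ∈ P) (h : xc θ w < xc θ v) :
    cntAfter P θ v (slopeAt θ v w) = (P.filter fun c => orient v w c < 0).card := by
  have hvw : v ≠ w := by rintro rfl; exact lt_irrefl _ h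
  unfold cntAfter
  congr 1
  apply Finset.filter_congr
  intro c hc
  by_cases hcv : c = v
  · subst hcv; simp [orient]
  have : orient v w c < 0 ↔ 0 < cross w v v c := by
    unfold orient cross
    constructor <;> intro h <;> linarith
  rw [this, cross_pos_iff h (Or.inr (hθ.ne hc hv hcv)), slopeAt_comm θ w v]
  simp only [WithTop.coe_le_coe, WithTop.coe_lt_coe]
  refine or_congr (and_congr_right fun h1 => ⟨fun h2 => lt_of_le_of_ne h2 ?_, le_of_lt⟩) Iff.rfl
  apply slopeAt_ne hP hθ hv hw hc hvw (Ne.symm hcv)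
  rintro rfl
  exact lt_asymm h h1

/-- By general position no other point is seen from `v` under this slope, so `w` alone changes
sides. -/
theorem cntAfter_eq_add_one_of_right {P : Finset Plane} {θ : ℝ} (hP : GeneralPosition P)
    (hθ : IsOrientation P θ) {v w : Plane} (hv : v ∈ P) (hw : w ∈ P) (h : xc θ v < xc θ w) :
    cntAfter P θ v (slopeAt θ v w) = cntBefore P θ v (slopeAt θ v w) + 1 := by
  classical
  have hvw : v ≠ w := by rintro rfl; exact lt_irrefl _ h
  unfold cntAfter cntBefore
  simp only [WithTop.coe_le_coe, WithTop.coe_lt_coe]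
  rw [← Finset.card_insert_of_notMem (a := w) (by simp [not_lt_of_gt h])]
  congr 1
  ext c
  simp only [Finset.mem_filter, Finset.mem_insert]
  by_cases hcw : c = w
  · subst hcw; simp [h, hw]
  simp only [hcw, false_or]
  refine and_congr_right fun hc => or_congr (and_congr_right fun h1 => ?_)
    (and_congr_right fun h1 => ?_)
  all_goals
    have hcv : v ≠ c := by rintro rfl; exact lt_irrefl _ h1
    have := slopeAt_ne hP hθ hv hc hw hcv hvw hcw
  · exact ⟨fun h2 => lt_of_le_of_ne h2 this.symm, le_of_lt⟩
  · exact ⟨le_of_lt, fun h2 => lt_of_le_of_ne h2 this⟩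

theorem cntBefore_eq_add_one_of_left {P : Finset Plane} {θ : ℝ} (hP : GeneralPosition P)
    (hθ : IsOrientation P θ) {v w : Plane} (hv : v ∈ P) (hw : w ∈ P) (h : xc θ w < xc θ v) :
    cntBefore P θ v (slopeAt θ v w) = cntAfter P θ v (slopeAt θ v w) + 1 := by
  classical
  have hvw : v ≠ w := by rintro rfl; exact lt_irrefl _ h
  unfold cntAfter cntBefore
  simp only [WithTop.coe_le_coe, WithTop.coe_lt_coe]
  rw [← Finset.card_insert_of_notMem (a := w) (by simp [not_lt_of_gt h])]
  congr 1
  ext c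
  simp only [Finset.mem_filter, Finset.mem_insert]
  by_cases hcw : c = w
  · subst hcw; simp [h, hw]
  simp only [hcw, false_or]
  refine and_congr_right fun hc => or_congr (and_congr_right fun h1 => ?_)
    (and_congr_right fun h1 => ?_)
  all_goals
    have hcv : v ≠ c := by rintro rfl; exact lt_irrefl _ h1
    have := slopeAt_ne hP hθ hv hc hw hcv hvw hcw
  · exact ⟨le_of_lt, fun h2 => lt_of_le_of_ne h2 this.symm⟩
  · exact ⟨fun h2 => lt_of_le_of_ne h2 this, le_of_lt⟩

/-- Passing a halving edge that goes to the right. -/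
theorem IsHalving.cnt_of_right {P : Finset Plane} {θ : ℝ} (hP : GeneralPosition P)
    (hθ : IsOrientation P θ) {v w : Plane} (hvw : IsHalving P v w) (h : xc θ v < xc θ w) :
    2 * cntBefore P θ v (slopeAt θ v w) < P.card ∧
      ¬ 2 * cntAfter P θ v (slopeAt θ v w) < P.card := by
  classical
  obtain ⟨hv, hw, hne, hc⟩ := hvw
  have h1 := card_pos_add_card_neg hP hv hw hne
  have h2 := cntBefore_of_right hP hθ hv hw h
  have h3 := cntAfter_eq_add_one_of_right hP hθ hv hw h
  omega

/-- Passing a halving edge that goes to the left. -/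
theorem IsHalving.cnt_of_left {P : Finset Plane} {θ : ℝ} (hP : GeneralPosition P)
    (hθ : IsOrientation P θ) {v w : Plane} (hvw : IsHalving P v w) (h : xc θ w < xc θ v) :
    ¬ 2 * cntBefore P θ v (slopeAt θ v w) < P.card ∧
      2 * cntAfter P θ v (slopeAt θ v w) < P.card := by
  classical
  obtain ⟨hv, hw, hne, hc⟩ := hvw
  have h1 := card_pos_add_card_neg hP hv hw hne
  have h2 := cntAfter_of_left hP hθ hv hw h
  have h3 := cntBefore_eq_add_one_of_left hP hθ hv hw h
  omega

/-- Passing a point that does not span a halving edge. -/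
theorem cnt_of_not_isHalving {P : Finset Plane} {θ : ℝ} (hn : Even P.card)
    (hP : GeneralPosition P) (hθ : IsOrientation P θ) {v w : Plane} (hv : v ∈ P) (hw : w ∈ P)
    (hne : v ≠ w) (hvw : ¬ IsHalving P v w) :
    2 * cntAfter P θ v (slopeAt θ v w) < P.card ↔
      2 * cntBefore P θ v (slopeAt θ v w) < P.card := by
  classical
  have hc : (P.filter fun c => 0 < orient v w c).card ≠
    (P.filter fun c => orient v w c < 0).card := fun h => hvw ⟨hv, hw, hne, h⟩
  have h1 := card_pos_add_card_neg hP hv hw hne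
  -- For even `P.card` the test changes only between the counts `P.card / 2 - 1` and `P.card / 2`,
  -- which are exactly the counts around a halving edge.
  obtain ⟨r, hr⟩ := hn
  rcases lt_or_gt_of_ne (hθ.ne hv hw hne) with h | h
  · have h2 := cntBefore_of_right hP hθ hv hw h
    have h3 := cntAfter_eq_add_one_of_right hP hθ hv hw h
    omega
  · have h2 := cntAfter_of_left hP hθ hv hw h
    have h3 := cntBefore_eq_add_one_of_left hP hθ hv hw h
    omega

theorem cntAfter_eq_cntBefore {P : Finset Plane} {θ : ℝ} {v : Plane} {m₁ : WithTop ℝ} {m₂ : ℝ}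
    (hm : (m₂ : WithTop ℝ) < m₁)
    (h : ∀ w ∈ P, w ≠ v → m₂ < slopeAt θ v w → ¬ (slopeAt θ v w : WithTop ℝ) < m₁) :
    cntAfter P θ v m₁ = cntBefore P θ v m₂ := by
  classical
  unfold cntAfter cntBefore
  congr 1
  apply Finset.filter_congr
  intro w hw
  by_cases hwv : w = v
  · subst hwv; simp
  specialize h w hw hwv
  refine or_congr (and_congr_right fun _ => ⟨fun h2 => ?_, fun h2 => not_lt.1 (h h2)⟩)
    (and_congr_right fun _ => ⟨fun h2 => ?_, fun h2 => ?_⟩)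
  · exact WithTop.coe_lt_coe.1 (hm.trans_le h2)
  · by_contra h3
    exact h (not_le.1 h3) h2
  · exact (WithTop.coe_le_coe.2 h2).trans_lt hm

/-- As long as the line rotating about `v` meets no halving edge, it keeps fewer than half of the
points above it, or at least half of the points above it. -/
theorem cnt_iff_of_gap {P : Finset Plane} {θ : ℝ} (hn : Even P.card)
    (hP : GeneralPosition P) (hθ : IsOrientation P θ) {v : Plane} (hv : v ∈ P) {m₂ : ℝ} :
    ∀ {m₁ : WithTop ℝ}, (m₂ : WithTop ℝ) < m₁ →
    (∀ w, IsHalving P v w → m₂ < slopeAt θ v w → ¬ (slopeAt θ v w : WithTop ℝ) < m₁) →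
    (2 * cntAfter P θ v m₁ < P.card ↔ 2 * cntBefore P θ v m₂ < P.card) := by
  classical
  -- Induction on the number of points passed; the first one met is the point of largest slope in
  -- the gap.
  suffices H : ∀ (N : ℕ) (m₁ : WithTop ℝ),
      (P.filter fun w => w ≠ v ∧ m₂ < slopeAt θ v w ∧ (slopeAt θ v w : WithTop ℝ) < m₁).card = N →
      (m₂ : WithTop ℝ) < m₁ →
      (∀ w, IsHalving P v w → m₂ < slopeAt θ v w → ¬ (slopeAt θ v w : WithTop ℝ) < m₁) →
      (2 * cntAfter P θ v m₁ < P.card ↔ 2 * cntBefore P θ v m₂ < P.card) from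
    fun {m₁} => H _ m₁ rfl
  intro N
  induction N using Nat.strong_induction_on with
  | _ N ih =>
    intro m₁ hN hm h
    rcases (P.filter fun w => w ≠ v ∧ m₂ < slopeAt θ v w ∧
      (slopeAt θ v w : WithTop ℝ) < m₁).eq_empty_or_nonempty with he | he
    · rw [cntAfter_eq_cntBefore hm]
      intro w hw hwv h1 h2
      exact Finset.eq_empty_iff_forall_notMem.1 he w (Finset.mem_filter.2 ⟨hw, hwv, h1, h2⟩)
    · obtain ⟨w, hw, hmax⟩ := Finset.exists_max_image _ (slopeAt θ v) he
      simp only [Finset.mem_filter, and_imp] at hw hmax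
      obtain ⟨hwP, hwv, h1, h2⟩ := hw
      have e1 : cntAfter P θ v m₁ = cntBefore P θ v (slopeAt θ v w) := by
        apply cntAfter_eq_cntBefore h2
        intro u hu huv h3 h4
        exact absurd (hmax u hu huv (h1.trans h3) h4) (not_le.2 h3)
      rw [e1, ← cnt_of_not_isHalving hn hP hθ hv hwP (Ne.symm hwv) fun h3 => h w h3 h1 h2]
      refine ih _ ?_ _ rfl (WithTop.coe_lt_coe.2 h1) ?_
      · rw [← hN]
        apply Finset.card_lt_card
        refine (Finset.ssubset_iff_of_subset ?_).2 ⟨w, ?_, ?_⟩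
        · intro u hu
          simp only [Finset.mem_filter] at hu ⊢
          exact ⟨hu.1, hu.2.1, hu.2.2.1, hu.2.2.2.trans h2⟩
        · simp [*]
        · simp
      · intro u hu h3 h4
        exact h u hu h3 (h4.trans h2)

/-! ### Existence of chains. -/

/-- No finite slope reaches `⊤`, so a line just turned away from the vertical has above it precisely
the points to the left of `v`. -/
theorem inLeftHalf_iff {P : Finset Plane} {θ : ℝ} {v : Plane} :
    InLeftHalf P θ v ↔ v ∈ P ∧ 2 * cntAfter P θ v ⊤ < P.card := by
  unfold InLeftHalf cntAfter
  simp

theorem isHalving_of_mem_edgeSet {P : Finset Plane} {e : Sym2 Plane} {v w : Plane}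
    (h : e ∈ (underlyingGraph P).edgeSet) (he : e = s(v, w)) : IsHalving P v w := by
  subst he; exact h

/-- If fewer than half of the points are above the rotating line, then the next edge goes to the
right, and still fewer than half of the points are above the line that goes on about its right
endpoint. -/
theorem IsNextEdge.right {P : Finset Plane} {θ : ℝ} (hn : Even P.card)
    (hP : GeneralPosition P) (hθ : IsOrientation P θ) {v w : Plane} {m : WithTop ℝ}
    (hlow : 2 * cntAfter P θ v m < P.card) (h : IsNextEdge P θ v m w) :
    xc θ v < xc θ w ∧ 2 * cntAfter P θ w (slopeAt θ v w) < P.card := by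
  obtain ⟨hvw, hm, hmax⟩ := h
  have hvw : IsHalving P v w := hvw
  have h1 := (cnt_iff_of_gap hn hP hθ hvw.1 hm
    (fun u hu h1 h2 => absurd (hmax u hu h2) (not_le.2 h1))).1 hlow
  have h2 : xc θ v < xc θ w := by
    by_contra h2
    exact (hvw.cnt_of_left hP hθ
      (lt_of_le_of_ne (not_lt.1 h2) (hθ.ne hvw.1 hvw.2.1 hvw.2.2.1).symm)).1 h1
  refine ⟨h2, ?_⟩
  rw [slopeAt_comm]
  exact (hvw.symm.cnt_of_left hP hθ h2).2

theorem exists_isNextEdge {P : Finset Plane} {θ : ℝ} {v w : Plane} {m : WithTop ℝ}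
    (hw : IsHalving P v w) (hm : (slopeAt θ v w : WithTop ℝ) < m) : ∃ u, IsNextEdge P θ v m u := by
  classical
  obtain ⟨u, hu, hmax⟩ := Finset.exists_max_image
    (P.filter fun u => IsHalving P v u ∧ (slopeAt θ v u : WithTop ℝ) < m) (slopeAt θ v)
    ⟨w, Finset.mem_filter.2 ⟨hw.2.1, hw, hm⟩⟩
  simp only [Finset.mem_filter, and_imp] at hu hmax
  exact ⟨u, hu.2.1, hu.2.2, fun x hx hxm => hmax x hx.2.1 hx hxm⟩

/-- Under the invariant `hlow` the pivot moves strictly to the right, so the rotation terminates. -/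
theorem exists_sweep {P : Finset Plane} {θ : ℝ} (hn : Even P.card)
    (hP : GeneralPosition P) (hθ : IsOrientation P θ) {v : Plane} {m : WithTop ℝ}
    (hlow : 2 * cntAfter P θ v m < P.card) : ∃ S, Sweep P θ v m S := by
  classical
  induction hN : (P.filter fun w => xc θ v < xc θ w).card using Nat.strong_induction_on
    generalizing v m with
  | _ N ih =>
    by_cases h : ∃ w, IsHalving P v w ∧ (slopeAt θ v w : WithTop ℝ) < m
    · obtain ⟨w, hw, hm⟩ := h
      obtain ⟨u, hu⟩ := exists_isNextEdge hw hm
      obtain ⟨h1, h2⟩ := hu.right hn hP hθ hlow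
      have hvu : IsHalving P v u := hu.1
      obtain ⟨S, hS⟩ := ih _ (by
        rw [← hN]
        apply Finset.card_lt_card
        refine (Finset.ssubset_iff_of_subset ?_).2 ⟨u, ?_, ?_⟩
        · intro x hx
          simp only [Finset.mem_filter] at hx ⊢
          exact ⟨hx.1, h1.trans hx.2⟩
        · simp [hvu.2.1, h1]
        · simp) h2 rfl
      refine ⟨_, Sweep.step v u m S hu ?_⟩
      rwa [rightmost, if_pos h1]
    · push Not at h
      exact ⟨[], Sweep.finish v m fun w hw => not_lt.2 (h w hw)⟩

/-- Every halving edge lies in a chain. -/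
theorem exists_isChain {P : Finset Plane} {θ : ℝ} (hn : Even P.card)
    (hP : GeneralPosition P) (hθ : IsOrientation P θ) {v w : Plane} (hvw : IsHalving P v w) :
    ∃ S, IsChain P θ S ∧ s(v, w) ∈ S := by
  classical
  -- The sweep is extended backwards by rotating counterclockwise about the left endpoint `v`. If no
  -- halving edge is met, the count shows that `v` is in the left half and starts the chain.
  -- Otherwise the count forces the first edge met to go left, and the argument is repeated from its
  -- left endpoint.
  have H : ∀ (N : ℕ) (v w : Plane) (S : List (Sym2 Plane)),
      (P.filter fun u => xc θ u < xc θ v).card = N → IsHalving P v w → xc θ v < xc θ w →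
      Sweep P θ w (slopeAt θ v w) S → ∃ S', IsChain P θ S' ∧ s(v, w) ∈ S' ∧ S ⊆ S' := by
    intro N
    induction N using Nat.strong_induction_on with
    | _ N ih =>
      intro v w S hN hvw h hS
      have hS : Sweep P θ (rightmost θ v w) (slopeAt θ v w) S := by
        rwa [rightmost, if_pos h]
      have hlow := (hvw.cnt_of_right hP hθ h).1
      rcases (P.filter fun u => IsHalving P v u ∧
        slopeAt θ v w < slopeAt θ v u).eq_empty_or_nonempty with he | he
      · have he' : ∀ u, IsHalving P v u → ¬ slopeAt θ v w < slopeAt θ v u := fun u hu h1 =>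
          Finset.eq_empty_iff_forall_notMem.1 he u (Finset.mem_filter.2 ⟨hu.2.1, hu, h1⟩)
        refine ⟨s(v, w) :: S, ⟨v, ?_, ?_⟩, by simp, by simp⟩
        · rw [inLeftHalf_iff]
          exact ⟨hvw.1, (cnt_iff_of_gap hn hP hθ hvw.1 (WithTop.coe_lt_top _)
            (fun u hu h1 => absurd h1 (he' u hu))).2 hlow⟩
        · exact Sweep.step v w ⊤ S
            ⟨hvw, WithTop.coe_lt_top _, fun u hu _ => not_lt.1 (he' u hu)⟩ hS
      · obtain ⟨u, hu, hmin⟩ := Finset.exists_min_image _ (slopeAt θ v) he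
        simp only [Finset.mem_filter, and_imp] at hu hmin
        obtain ⟨huP, hvu, hs⟩ := hu
        have hlow' := (cnt_iff_of_gap (m₁ := (slopeAt θ v u : WithTop ℝ)) hn hP hθ hvw.1
          (WithTop.coe_lt_coe.2 hs) (fun x hx h1 h2 => absurd (hmin x hx.2.1 hx h1)
            (not_le.2 (WithTop.coe_lt_coe.1 h2)))).2 hlow
        have huv : xc θ u < xc θ v := by
          by_contra h2
          exact (hvu.cnt_of_right hP hθ (lt_of_le_of_ne (not_lt.1 h2)
            (hθ.ne hvu.1 hvu.2.1 hvu.2.2.1))).2 hlow'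
        obtain ⟨S', hS', -, hsub⟩ := ih _ (by
          rw [← hN]
          apply Finset.card_lt_card
          refine (Finset.ssubset_iff_of_subset ?_).2 ⟨u, ?_, ?_⟩
          · intro x hx
            simp only [Finset.mem_filter] at hx ⊢
            exact ⟨hx.1, hx.2.trans huv⟩
          · simp [huP, huv]
          · simp) u v (s(v, w) :: S) rfl hvu.symm huv (by
            rw [slopeAt_comm θ u v]
            refine Sweep.step v w _ S ⟨hvw, WithTop.coe_lt_coe.2 hs, fun x hx h1 => ?_⟩ hS
            by_contra h2
            exact absurd (hmin x hx.2.1 hx (not_le.1 h2)) (not_le.2 (WithTop.coe_lt_coe.1 h1)))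
        exact ⟨S', hS', hsub (by simp), fun x hx => hsub (by simp [hx])⟩
  have H' : ∀ v w, IsHalving P v w → xc θ v < xc θ w → ∃ S, IsChain P θ S ∧ s(v, w) ∈ S := by
    intro v w hvw h
    obtain ⟨S, hS⟩ := exists_sweep hn hP hθ (v := w) (m := slopeAt θ v w) (by
      rw [slopeAt_comm]; exact (hvw.symm.cnt_of_left hP hθ h).2)
    obtain ⟨S', h1, h2, -⟩ := H _ v w S rfl hvw h hS
    exact ⟨S', h1, h2⟩
  rcases lt_or_gt_of_ne (hθ.ne hvw.1 hvw.2.1 hvw.2.2.1) with h | h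
  · exact H' v w hvw h
  · rw [Sym2.eq_swap]
    exact H' w v hvw.symm h

/-! ### Chains as sequences of vertices. -/

/-- The slope of the rotating line at the moment it starts to rotate about `p i`. -/
noncomputable def inSlope (θ : ℝ) (m : WithTop ℝ) (p : ℕ → Plane) : ℕ → WithTop ℝ
  | 0 => m
  | i + 1 => (slopeAt θ (p i) (p (i + 1)) : WithTop ℝ)

/-- `p 0, …, p k` are the successive vertices of the rotation process started from `p 0` with
slope `m`. -/
structure SweepsOut (P : Finset Plane) (θ : ℝ) (m : WithTop ℝ) (k : ℕ) (p : ℕ → Plane) :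
    Prop where
  mem : ∀ i ≤ k, p i ∈ P
  next : ∀ i < k, IsNextEdge P θ (p i) (inSlope θ m p i) (p (i + 1))
  lt : ∀ i < k, xc θ (p i) < xc θ (p (i + 1))
  last : ∀ w, IsHalving P (p k) w → ¬ (slopeAt θ (p k) w : WithTop ℝ) < inSlope θ m p k
  low : ∀ i ≤ k, 2 * cntAfter P θ (p i) (inSlope θ m p i) < P.card

/-- The count invariant makes every collected edge go right, so `rightmost` always returns the new
endpoint and the edges join consecutive vertices. -/
theorem Sweep.exists_sweepsOut {P : Finset Plane} {θ : ℝ} (hn : Even P.card)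
    (hP : GeneralPosition P) (hθ : IsOrientation P θ) {v : Plane} {m : WithTop ℝ}
    {S : List (Sym2 Plane)} (hS : Sweep P θ v m S) (hv : v ∈ P)
    (hlow : 2 * cntAfter P θ v m < P.card) :
    ∃ k p, p 0 = v ∧ SweepsOut P θ m k p ∧ ∀ e, e ∈ S ↔ ∃ i < k, e = s(p i, p (i + 1)) := by
  induction hS with
  | finish v m h =>
    exact ⟨0, fun _ => v, rfl, ⟨fun _ _ => hv, by simp, by simp, h, fun i hi => by
      obtain rfl : i = 0 := by omega
      exact hlow⟩, by simp⟩
  | step v w m S h hS ih =>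
    obtain ⟨h1, h2⟩ := h.right hn hP hθ hlow
    have hvw : IsHalving P v w := h.1
    rw [rightmost, if_pos h1] at ih
    obtain ⟨k, p, rfl, hp, hmem⟩ := ih hvw.2.1 h2
    have e : ∀ i, inSlope θ m (fun n => Nat.casesOn n v p) (i + 1) =
        inSlope θ (slopeAt θ v (p 0)) p i := by
      rintro (_ | i) <;> rfl
    refine ⟨k + 1, fun n => Nat.casesOn n v p, rfl, ⟨?_, ?_, ?_, ?_, ?_⟩, ?_⟩
    · rintro (_ | i) hi
      · exact hv
      · exact hp.mem i (by omega)
    · rintro (_ | i) hi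
      · exact h
      · rw [e]; exact hp.next i (by omega)
    · rintro (_ | i) hi
      · exact h1
      · exact hp.lt i (by omega)
    · rw [e]; exact hp.last
    · rintro (_ | i) hi
      · exact hlow
      · rw [e]; exact hp.low i (by omega)
    · intro f
      rw [List.mem_cons, hmem]
      constructor
      · rintro (rfl | ⟨i, hi, rfl⟩)
        · exact ⟨0, by omega, rfl⟩
        · exact ⟨i + 1, by omega, rfl⟩
      · rintro ⟨_ | i, hi, rfl⟩
        · exact Or.inl rfl
        · exact Or.inr ⟨i, by omega, rfl⟩

theorem IsChain.exists_sweepsOut {P : Finset Plane} {θ : ℝ} (hn : Even P.card)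
    (hP : GeneralPosition P) (hθ : IsOrientation P θ) {S : List (Sym2 Plane)}
    (hS : IsChain P θ S) :
    ∃ k p, SweepsOut P θ ⊤ k p ∧ ∀ e, e ∈ S ↔ ∃ i < k, e = s(p i, p (i + 1)) := by
  obtain ⟨v, hv, hS⟩ := hS
  rw [inLeftHalf_iff] at hv
  obtain ⟨k, p, -, h⟩ := hS.exists_sweepsOut hn hP hθ hv.1 hv.2
  exact ⟨k, p, h⟩

/-! ### Heights of lines and concavity of chains. -/

/-- Height over `x` of the line through `a` and `b`. -/
noncomputable def lineAt (θ : ℝ) (a b : Plane) (x : ℝ) : ℝ :=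
  yc θ a + slopeAt θ a b * (x - xc θ a)

theorem strictlyBelow_iff {θ : ℝ} {a b v : Plane} :
    StrictlyBelow θ a b v ↔ yc θ v < lineAt θ a b (xc θ v) := Iff.rfl

theorem lineAt_left (θ : ℝ) (a b : Plane) : lineAt θ a b (xc θ a) = yc θ a := by
  simp [lineAt]

theorem lineAt_right {θ : ℝ} {a b : Plane} (h : xc θ a ≠ xc θ b) :
    lineAt θ a b (xc θ b) = yc θ b := by
  have := sub_ne_zero.2 h.symm
  unfold lineAt slopeAt
  field_simp
  ring

theorem lineAt_sub (θ : ℝ) (a b : Plane) (x y : ℝ) :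
    lineAt θ a b y = lineAt θ a b x + slopeAt θ a b * (y - x) := by
  unfold lineAt; ring

/-- An affine function over an interior point of `[s, t]` in terms of its values at the ends. -/
theorem lineAt_mul (θ : ℝ) (a b : Plane) (s t x : ℝ) :
    lineAt θ a b x * (t - s) = (t - x) * lineAt θ a b s + (x - s) * lineAt θ a b t := by
  unfold lineAt; ring

theorem lineAt_le_lineAt {θ : ℝ} {a b c d : Plane} {x : ℝ} (ha : xc θ a < x) (hb : x < xc θ b)
    (h₁ : yc θ a ≤ lineAt θ c d (xc θ a)) (h₂ : yc θ b ≤ lineAt θ c d (xc θ b)) :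
    lineAt θ a b x ≤ lineAt θ c d x := by
  have e₁ := lineAt_mul θ a b (xc θ a) (xc θ b) x
  have e₂ := lineAt_mul θ c d (xc θ a) (xc θ b) x
  rw [lineAt_left, lineAt_right (ha.trans hb).ne] at e₁
  have := mul_le_mul_of_nonneg_left h₁ (sub_nonneg.2 hb.le)
  have := mul_le_mul_of_nonneg_left h₂ (sub_nonneg.2 ha.le)
  exact le_of_mul_le_mul_right (by linarith) (sub_pos.2 (ha.trans hb))

/-- A segment `cd` over `x` that stays below the line `ab` but reaches it over `x` is `ab`. -/
theorem eq_of_lineAt_le {θ : ℝ} {a b c d : Plane} {x : ℝ} (ha : xc θ a < x) (hb : x < xc θ b)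
    (hc : xc θ c < x) (hd : x < xc θ d) (h₁ : c ≠ a → c ≠ b → StrictlyBelow θ a b c)
    (h₂ : d ≠ a → d ≠ b → StrictlyBelow θ a b d) (h : lineAt θ a b x ≤ lineAt θ c d x) :
    c = a ∧ d = b := by
  have hcb : c ≠ b := by rintro rfl; exact lt_asymm hc hb
  have hda : d ≠ a := by rintro rfl; exact lt_asymm hd ha
  have e₁ := lineAt_mul θ a b (xc θ c) (xc θ d) x
  have e₂ := lineAt_mul θ c d (xc θ c) (xc θ d) x
  rw [lineAt_left, lineAt_right (hc.trans hd).ne] at e₂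
  have l₁ : yc θ c ≤ lineAt θ a b (xc θ c) := by
    by_cases e : c = a
    · rw [e, lineAt_left]
    · exact le_of_lt (h₁ e hcb)
  have l₂ : yc θ d ≤ lineAt θ a b (xc θ d) := by
    by_cases e : d = b
    · rw [e, lineAt_right (ha.trans hb).ne]
    · exact le_of_lt (h₂ hda e)
  have h' := mul_le_mul_of_nonneg_right h (sub_pos.2 (hc.trans hd)).le
  constructor
  · by_contra e
    have := mul_lt_mul_of_pos_left (strictlyBelow_iff.1 (h₁ e hcb)) (sub_pos.2 hd)
    have := mul_le_mul_of_nonneg_left l₂ (sub_pos.2 hc).le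
    linarith
  · by_contra e
    have := mul_lt_mul_of_pos_left (strictlyBelow_iff.1 (h₂ hda e)) (sub_pos.2 hc)
    have := mul_le_mul_of_nonneg_left l₁ (sub_pos.2 hd).le
    linarith

theorem exists_of_mem_openSegment {a b z : Plane} (hz : z ∈ openSegment ℝ a b) :
    ∃ s : ℝ, 0 < s ∧ s < 1 ∧ ∀ i, z i = a i + s * (b i - a i) := by
  obtain ⟨s, t, hs, ht, hst, rfl⟩ := hz
  refine ⟨t, ht, by linarith, fun i => ?_⟩
  simp
  linear_combination (a i) * hst

theorem xc_lt_of_mem_openSegment {θ : ℝ} {a b z : Plane} (hz : z ∈ openSegment ℝ a b)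
    (h : xc θ a < xc θ b) : xc θ a < xc θ z ∧ xc θ z < xc θ b := by
  obtain ⟨s, h0, h1, e⟩ := exists_of_mem_openSegment hz
  have : xc θ z = xc θ a + s * (xc θ b - xc θ a) := by
    unfold xc; rw [e, e]; ring
  have h2 : 0 < xc θ b - xc θ a := by linarith
  constructor <;> nlinarith

theorem yc_of_mem_openSegment {θ : ℝ} {a b z : Plane} (hz : z ∈ openSegment ℝ a b)
    (h : xc θ a < xc θ b) : yc θ z = lineAt θ a b (xc θ z) := by
  obtain ⟨s, h0, h1, e⟩ := exists_of_mem_openSegment hz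
  have e1 : xc θ z = xc θ a + s * (xc θ b - xc θ a) := by
    unfold xc; rw [e, e]; ring
  have e2 : yc θ z = yc θ a + s * (yc θ b - yc θ a) := by
    unfold yc; rw [e, e]; ring
  have h2 : xc θ b - xc θ a ≠ 0 := by linarith
  rw [e1, e2]
  unfold lineAt slopeAt
  field_simp
  ring

namespace SweepsOut

variable {P : Finset Plane} {θ : ℝ} {m : WithTop ℝ} {k : ℕ} {p : ℕ → Plane}

theorem halving (hp : SweepsOut P θ m k p) {i : ℕ} (hi : i < k) :
    IsHalving P (p i) (p (i + 1)) := (hp.next i hi).1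

theorem xc_lt (hp : SweepsOut P θ m k p) {i j : ℕ} (hij : i < j) (hj : j ≤ k) :
    xc θ (p i) < xc θ (p j) := by
  induction j, hij using Nat.le_induction with
  | base => exact hp.lt i hj
  | succ j _ ih => exact (ih (by omega)).trans (hp.lt j hj)

theorem xc_le (hp : SweepsOut P θ m k p) {i j : ℕ} (hij : i ≤ j) (hj : j ≤ k) :
    xc θ (p i) ≤ xc θ (p j) := by
  rcases hij.eq_or_lt with rfl | h
  · exact le_rfl
  · exact (hp.xc_lt h hj).le

theorem lt_of_xc_lt (hp : SweepsOut P θ m k p) {i j : ℕ} (hi : i ≤ k)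
    (h : xc θ (p i) < xc θ (p j)) : i < j := by
  by_contra h'
  exact absurd h (not_lt.2 (hp.xc_le (not_lt.1 h') hi))

theorem slope_lt (hp : SweepsOut P θ m k p) {i j : ℕ} (hij : i < j) (hj : j < k) :
    slopeAt θ (p j) (p (j + 1)) < slopeAt θ (p i) (p (i + 1)) := by
  have h1 : ∀ j, j + 1 < k → slopeAt θ (p (j + 1)) (p (j + 2)) < slopeAt θ (p j) (p (j + 1)) :=
    fun j hj => WithTop.coe_lt_coe.1 (hp.next (j + 1) hj).2.1
  induction j, hij using Nat.le_induction with
  | base => exact h1 i hj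
  | succ j _ ih => exact (h1 j hj).trans (ih (by omega))

/-- Slopes decrease along a chain, so it is concave and the line of each edge supports it from
above. The induction runs outwards from the edge in both directions. -/
theorem yc_lt_lineAt (hp : SweepsOut P θ m k p) {i t : ℕ} (hi : i < k) (ht : t ≤ k) :
    yc θ (p t) ≤ lineAt θ (p i) (p (i + 1)) (xc θ (p t)) ∧
    (t ≠ i → t ≠ i + 1 → yc θ (p t) < lineAt θ (p i) (p (i + 1)) (xc θ (p t))) := by
  have step : ∀ t < k, yc θ (p (t + 1)) = yc θ (p t) +
      slopeAt θ (p t) (p (t + 1)) * (xc θ (p (t + 1)) - xc θ (p t)) := fun t ht => by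
    rw [← lineAt_right (hp.lt t ht).ne]; rfl
  rcases Nat.lt_or_ge i t with h | h
  · induction t, h using Nat.le_induction with
    | base => simp [lineAt_right (hp.lt i hi).ne]
    | succ t hit ih =>
      have h1 := (ih (by omega)).1
      have h2 := mul_lt_mul_of_pos_right (hp.slope_lt hit (show t < k from ht))
        (sub_pos.2 (hp.lt t ht))
      have h3 : yc θ (p (t + 1)) < lineAt θ (p i) (p (i + 1)) (xc θ (p (t + 1))) := by
        rw [step t ht, lineAt_sub θ _ _ (xc θ (p t))]
        linarith
      exact ⟨h3.le, fun _ _ => h3⟩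
  · obtain ⟨d, rfl⟩ : ∃ d, i = t + d := ⟨i - t, by omega⟩
    induction d generalizing t with
    | zero => simp [lineAt_left]
    | succ d ih =>
      have e : t + (d + 1) = t + 1 + d := by ring
      rw [e] at hi ⊢
      have h1 := (ih (t := t + 1) (by omega) hi (by omega)).1
      have h2 := mul_lt_mul_of_pos_right (hp.slope_lt (show t < t + 1 + d by omega) hi)
        (sub_pos.2 (hp.lt t (by omega)))
      rw [step t (by omega), lineAt_sub θ _ _ (xc θ (p t))] at h1
      have h3 : yc θ (p t) < lineAt θ (p (t + 1 + d)) (p (t + 1 + d + 1)) (xc θ (p t)) := by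
        linarith
      exact ⟨h3.le, fun _ _ => h3⟩

/-- A chord of a chain lies below the chain. -/
theorem lineAt_le (hp : SweepsOut P θ m k p) {i s t : ℕ} (hi : i < k) (hs : s ≤ k) (ht : t ≤ k)
    {x : ℝ} (h₁ : xc θ (p s) < x) (h₂ : x < xc θ (p t)) :
    lineAt θ (p s) (p t) x ≤ lineAt θ (p i) (p (i + 1)) x :=
  lineAt_le_lineAt h₁ h₂ (hp.yc_lt_lineAt hi hs).1 (hp.yc_lt_lineAt hi ht).1

theorem index_eq (hp : SweepsOut P θ m k p) {i j : ℕ} (hi : i < k) (hj : j < k) {x : ℝ}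
    (h₁ : xc θ (p i) < x) (h₂ : x < xc θ (p (i + 1))) (h₃ : xc θ (p j) < x)
    (h₄ : x < xc θ (p (j + 1))) : i = j := by
  have := hp.lt_of_xc_lt hi.le (h₁.trans h₄)
  have := hp.lt_of_xc_lt hj.le (h₃.trans h₂)
  omega

/-- No vertex of a chain is on the vertical line through an interior point of an edge. -/
theorem xc_ne (hp : SweepsOut P θ m k p) {i t : ℕ} (hi : i < k) (ht : t ≤ k) {x : ℝ}
    (h₁ : xc θ (p i) < x) (h₂ : x < xc θ (p (i + 1))) : xc θ (p t) ≠ x := by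
  rintro rfl
  have := hp.lt_of_xc_lt hi.le h₁
  have := hp.lt_of_xc_lt ht h₂
  omega

end SweepsOut

/-! ### Common tangents over a crossing, in one orientation. -/

/-- Two edges `p i p (i + 1)`, `q j q (j + 1)` of chains with vertices `p 0, …, p k` and
`q 0, …, q l` that cross at `z`, and a common upper tangent through `p i₀` and `q j₀` over `z`. -/
structure TangentOver (P : Finset Plane) (θ : ℝ) (k : ℕ) (p : ℕ → Plane) (l : ℕ) (q : ℕ → Plane)
    (i j i₀ j₀ : ℕ) (z : Plane) : Prop where
  hp : SweepsOut P θ ⊤ k p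
  hq : SweepsOut P θ ⊤ l q
  hi : i < k
  hj : j < l
  hi₀ : i₀ ≤ k
  hj₀ : j₀ ≤ l
  ne : s(p i, p (i + 1)) ≠ s(q j, q (j + 1))
  zp : z ∈ openSegment ℝ (p i) (p (i + 1))
  zq : z ∈ openSegment ℝ (q j) (q (j + 1))
  lt_z : xc θ (p i₀) < xc θ z
  z_lt : xc θ z < xc θ (q j₀)
  below_p : ∀ t ≤ k, p t ≠ p i₀ → p t ≠ q j₀ → StrictlyBelow θ (p i₀) (q j₀) (p t)
  below_q : ∀ t ≤ l, q t ≠ p i₀ → q t ≠ q j₀ → StrictlyBelow θ (p i₀) (q j₀) (q t)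

namespace TangentOver

variable {P : Finset Plane} {θ : ℝ} {k l i j i₀ j₀ : ℕ} {p q : ℕ → Plane} {z : Plane}

theorem lt_p (h : TangentOver P θ k p l q i j i₀ j₀ z) : xc θ (p i) < xc θ z :=
  (xc_lt_of_mem_openSegment h.zp (h.hp.lt i h.hi)).1

theorem p_lt (h : TangentOver P θ k p l q i j i₀ j₀ z) : xc θ z < xc θ (p (i + 1)) :=
  (xc_lt_of_mem_openSegment h.zp (h.hp.lt i h.hi)).2

theorem lt_q (h : TangentOver P θ k p l q i j i₀ j₀ z) : xc θ (q j) < xc θ z :=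
  (xc_lt_of_mem_openSegment h.zq (h.hq.lt j h.hj)).1

theorem q_lt (h : TangentOver P θ k p l q i j i₀ j₀ z) : xc θ z < xc θ (q (j + 1)) :=
  (xc_lt_of_mem_openSegment h.zq (h.hq.lt j h.hj)).2

theorem yc_p (h : TangentOver P θ k p l q i j i₀ j₀ z) :
    yc θ z = lineAt θ (p i) (p (i + 1)) (xc θ z) :=
  yc_of_mem_openSegment h.zp (h.hp.lt i h.hi)

theorem yc_q (h : TangentOver P θ k p l q i j i₀ j₀ z) :
    yc θ z = lineAt θ (q j) (q (j + 1)) (xc θ z) :=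
  yc_of_mem_openSegment h.zq (h.hq.lt j h.hj)

/-- If the crossing point reached the tangent, both crossing edges would be the tangent segment
itself, but they are distinct. -/
theorem yc_lt (h : TangentOver P θ k p l q i j i₀ j₀ z) :
    yc θ z < lineAt θ (p i₀) (q j₀) (xc θ z) := by
  by_contra h'
  have h1 := h.yc_p ▸ not_lt.1 h'
  have h2 := h.yc_q ▸ not_lt.1 h'
  obtain ⟨e1, e2⟩ := eq_of_lineAt_le h.lt_z h.z_lt h.lt_p h.p_lt (h.below_p i h.hi.le)
    (h.below_p _ h.hi) h1
  obtain ⟨e3, e4⟩ := eq_of_lineAt_le h.lt_z h.z_lt h.lt_q h.q_lt (h.below_q j h.hj.le)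
    (h.below_q _ h.hj) h2
  exact h.ne (by rw [e1, e2, e3, e4])

/-- If the right tangent vertex were on the left chain, the tangent would be a chord of that chain
and could not pass above `z`. -/
theorem p_ne (h : TangentOver P θ k p l q i j i₀ j₀ z) {t : ℕ} (ht : t ≤ k) : p t ≠ q j₀ := by
  intro e
  have h1 := h.hp.lineAt_le h.hi h.hi₀ ht h.lt_z (e ▸ h.z_lt)
  rw [e, ← h.yc_p] at h1
  exact absurd h.yc_lt (not_lt.2 h1)

theorem q_ne (h : TangentOver P θ k p l q i j i₀ j₀ z) {t : ℕ} (ht : t ≤ l) : q t ≠ p i₀ := by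
  intro e
  have h1 := h.hq.lineAt_le h.hj ht h.hj₀ (e ▸ h.lt_z) h.z_lt
  rw [e, ← h.yc_q] at h1
  exact absurd h.yc_lt (not_lt.2 h1)

/-- Two chains with a common upper tangent cross only once below the tangent segment. -/
theorem not_lt_of_lt {i' j' : ℕ} {z' : Plane} (h : TangentOver P θ k p l q i j i₀ j₀ z)
    (h' : TangentOver P θ k p l q i' j' i₀ j₀ z') : ¬ xc θ z < xc θ z' := by
  intro hlt
  -- Measure heights relative to the tangent. The line of edge `i` is not below it at `p i₀` and is
  -- below it at `z`, so it is lower still at `z'`; by concavity `z'` is not above that line, hence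
  -- is lower than `z`. The line of edge `j'`, followed leftwards from `q j₀`, gives the opposite
  -- inequality.
  have hz := h.yc_lt
  have hz' := h'.yc_lt
  have a1 := (h.hp.yc_lt_lineAt h.hi h.hi₀).1
  have a2 := lineAt_le_lineAt h'.lt_p h'.p_lt (h.hp.yc_lt_lineAt h.hi h'.hi.le).1
    (h.hp.yc_lt_lineAt h.hi h'.hi).1
  have b1 := (h.hq.yc_lt_lineAt h'.hj h.hj₀).1
  have b2 := lineAt_le_lineAt h.lt_q h.q_lt (h.hq.yc_lt_lineAt h'.hj h.hj.le).1
    (h.hq.yc_lt_lineAt h'.hj h.hj).1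
  rw [← h'.yc_p] at a2
  rw [← h.yc_q] at b2
  rw [h.yc_p] at hz
  rw [h'.yc_q] at hz'
  have ea := lineAt_mul θ (p i) (p (i + 1)) (xc θ (p i₀)) (xc θ z') (xc θ z)
  have ea' := lineAt_mul θ (p i₀) (q j₀) (xc θ (p i₀)) (xc θ z') (xc θ z)
  have eb := lineAt_mul θ (q j') (q (j' + 1)) (xc θ z) (xc θ (q j₀)) (xc θ z')
  have eb' := lineAt_mul θ (p i₀) (q j₀) (xc θ z) (xc θ (q j₀)) (xc θ z')
  rw [lineAt_left] at ea'
  rw [lineAt_right (h.lt_z.trans h.z_lt).ne] at eb'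
  rw [← h.yc_p] at hz ea
  rw [← h'.yc_q] at hz' eb
  have c1 := h.lt_z
  have c2 := h'.z_lt
  generalize lineAt θ (p i) (p (i + 1)) (xc θ z') = A at *
  generalize lineAt θ (p i) (p (i + 1)) (xc θ (p i₀)) = A0 at *
  generalize lineAt θ (q j') (q (j' + 1)) (xc θ z) = B at *
  generalize lineAt θ (q j') (q (j' + 1)) (xc θ (q j₀)) = B0 at *
  generalize lineAt θ (p i₀) (q j₀) (xc θ z) = Lz at *
  generalize lineAt θ (p i₀) (q j₀) (xc θ z') = Lz' at *
  have k1 : A - Lz' < yc θ z - Lz := by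
    by_contra hc
    nlinarith [mul_nonneg (sub_nonneg.2 a1) (sub_pos.2 hlt).le,
      mul_nonneg (sub_nonneg.2 (not_lt.1 hc)) (sub_pos.2 c1).le,
      mul_pos (sub_pos.2 hz) (sub_pos.2 hlt)]
  have k2 : B - Lz < yc θ z' - Lz' := by
    by_contra hc
    nlinarith [mul_nonneg (sub_nonneg.2 b1) (sub_pos.2 hlt).le,
      mul_nonneg (sub_nonneg.2 (not_lt.1 hc)) (sub_pos.2 c2).le,
      mul_pos (sub_pos.2 hz') (sub_pos.2 hlt)]
  linarith

theorem index_eq {i' j' : ℕ} {z' : Plane} (h : TangentOver P θ k p l q i j i₀ j₀ z)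
    (h' : TangentOver P θ k p l q i' j' i₀ j₀ z') : i = i' ∧ j = j' := by
  have e : xc θ z = xc θ z' :=
    le_antisymm (not_lt.1 (h'.not_lt_of_lt h)) (not_lt.1 (h.not_lt_of_lt h'))
  exact ⟨h.hp.index_eq h.hi h'.hi h.lt_p h.p_lt (e ▸ h'.lt_p) (e ▸ h'.p_lt),
    h.hq.index_eq h.hj h'.hj h.lt_q h.q_lt (e ▸ h'.lt_q) (e ▸ h'.q_lt)⟩

end TangentOver

theorem edgeInterior_mk (a b : Plane) : edgeInterior s(a, b) = openSegment ℝ a b := by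
  ext z
  constructor
  · rintro ⟨c, d, h, hz⟩
    rcases Sym2.eq_iff.1 h with ⟨rfl, rfl⟩ | ⟨rfl, rfl⟩
    · exact hz
    · rwa [openSegment_symm]
  · exact fun hz => ⟨a, b, rfl, hz⟩

/-! ### Continuing a chain independently of the orientation. -/

/-- The linear relation between three vectors of the plane, read in the left-to-right coordinate. It
decides on which side of `v` a direction lies that is between two directions of known sides. -/
theorem xc_interp (θ : ℝ) (a b v w w' : Plane) :
    cross a b v w' * (xc θ w - xc θ v) =
      cross v w v w' * (xc θ b - xc θ a) + cross a b v w * (xc θ w' - xc θ v) := by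
  unfold cross xc; ring

theorem cross_ne_zero {P : Finset Plane} (hP : GeneralPosition P) {v w w' : Plane}
    (hw : IsHalving P v w) (hw' : IsHalving P v w') (h : w ≠ w') : cross v w v w' ≠ 0 :=
  orient_ne_zero hP hw.1 hw.2.1 hw'.2.1 hw.2.2.1 hw'.2.2.1 h

/-- A line with the direction of `ab` that rotates clockwise about `v` meets the same halving edge
first, to the right of `v`, in any two orientations in which it does so. -/
theorem eq_of_next_right {P : Finset Plane} (hP : GeneralPosition P) {θ φ : ℝ}
    {a b v w w' : Plane} (hw : IsHalving P v w) (hw' : IsHalving P v w')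
    (h₁ : xc θ a < xc θ b) (h₁' : xc φ a < xc φ b) (h₂ : xc θ v < xc θ w)
    (h₂' : xc φ v < xc φ w') (h₃ : slopeAt θ v w < slopeAt θ a b)
    (h₃' : slopeAt φ v w' < slopeAt φ a b)
    (h₄ : ∀ u, IsHalving P v u → slopeAt θ v u < slopeAt θ a b → slopeAt θ v u ≤ slopeAt θ v w)
    (h₄' : ∀ u, IsHalving P v u → slopeAt φ v u < slopeAt φ a b →
      slopeAt φ v u ≤ slopeAt φ v w') : w = w' := by
  by_contra hne
  -- Here `vw` is in the cone spanned by `ab` and `vw'`. Both of these go right for `φ`, so `vw`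
  -- does too, and it would be met before `vw'`.
  have key : ∀ (φ : ℝ) (w w' : Plane), IsHalving P v w → cross a b v w < 0 → cross a b v w' < 0 →
      cross v w v w' < 0 → xc φ a < xc φ b → xc φ v < xc φ w' →
      ¬ ∀ u, IsHalving P v u → slopeAt φ v u < slopeAt φ a b →
        slopeAt φ v u ≤ slopeAt φ v w' := by
    intro φ w w' hw c1 c2 c3 x1 x2 H
    have x3 : xc φ v < xc φ w := by
      have := xc_interp φ a b v w w'
      have := mul_neg_of_neg_of_pos c3 (sub_pos.2 x1)
      have := mul_neg_of_neg_of_pos c1 (sub_pos.2 x2)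
      by_contra hc
      have := mul_nonneg_of_nonpos_of_nonpos c2.le (sub_nonpos.2 (not_lt.1 hc))
      linarith
    exact absurd (H w hw ((slopeAt_lt_iff x1 x3).2 c1)) (not_le.2 ((slopeAt_lt_iff x3 x2).2 c3))
  have c1 := (slopeAt_lt_iff h₁ h₂).1 h₃
  have c2 := (slopeAt_lt_iff h₁' h₂').1 h₃'
  rcases lt_or_gt_of_ne (cross_ne_zero hP hw hw' hne) with c3 | c3
  · exact key φ w w' hw c1 c2 c3 h₁' h₂' h₄'
  · refine key θ w' w hw' c2 c1 ?_ h₁ h₂ h₄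
    unfold cross at c3 ⊢; linarith

/-- A line with the direction of `ab` that rotates counterclockwise about `v` meets the same halving
edge first, to the left of `v`, in any two orientations in which it does so. -/
theorem eq_of_next_left {P : Finset Plane} (hP : GeneralPosition P) {θ φ : ℝ}
    {a b v w w' : Plane} (hw : IsHalving P v w) (hw' : IsHalving P v w')
    (h₁ : xc θ a < xc θ b) (h₁' : xc φ a < xc φ b) (h₂ : xc θ w < xc θ v)
    (h₂' : xc φ w' < xc φ v) (h₃ : slopeAt θ a b < slopeAt θ w v)
    (h₃' : slopeAt φ a b < slopeAt φ w' v)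
    (h₄ : ∀ u, IsHalving P v u → slopeAt θ v u < slopeAt θ w v → slopeAt θ v u ≤ slopeAt θ a b)
    (h₄' : ∀ u, IsHalving P v u → slopeAt φ v u < slopeAt φ w' v →
      slopeAt φ v u ≤ slopeAt φ a b) : w = w' := by
  by_contra hne
  -- Here `vw` is in the cone spanned by `vw'` and the reverse of `ab`, both going left for `φ`, so
  -- its slope falls strictly inside the gap.
  have key : ∀ (φ : ℝ) (w w' : Plane), IsHalving P v w → cross a b v w < 0 → cross a b v w' < 0 →
      0 < cross v w v w' → xc φ a < xc φ b → xc φ w' < xc φ v →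
      ¬ ∀ u, IsHalving P v u → slopeAt φ v u < slopeAt φ w' v →
        slopeAt φ v u ≤ slopeAt φ a b := by
    intro φ w w' hw c1 c2 c3 x1 x2 H
    have x3 : xc φ w < xc φ v := by
      have := xc_interp φ a b v w w'
      have := mul_pos c3 (sub_pos.2 x1)
      have := mul_pos_of_neg_of_neg c1 (sub_neg.2 x2)
      by_contra hc
      have := mul_nonpos_of_nonpos_of_nonneg c2.le (sub_nonneg.2 (not_lt.1 hc))
      linarith
    have s1 : slopeAt φ v w < slopeAt φ w' v := by
      rw [slopeAt_comm φ v w, slopeAt_lt_iff x2 x3]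
      unfold cross at c3 ⊢; linarith
    have s2 : slopeAt φ a b < slopeAt φ v w := by
      rw [slopeAt_comm φ v w, slopeAt_lt_iff x3 x1]
      unfold cross at c1 ⊢; linarith
    exact absurd (H w hw s1) (not_le.2 s2)
  have c1 : cross a b v w < 0 := by
    have := (slopeAt_lt_iff h₂ h₁).1 h₃
    unfold cross at this ⊢; linarith
  have c2 : cross a b v w' < 0 := by
    have := (slopeAt_lt_iff h₂' h₁').1 h₃'
    unfold cross at this ⊢; linarith
  rcases lt_or_gt_of_ne (cross_ne_zero hP hw hw' hne) with c3 | c3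
  · refine key θ w' w hw' c2 c1 ?_ h₁ h₂ h₄
    unfold cross at c3 ⊢; linarith
  · exact key φ w w' hw c1 c2 c3 h₁' h₂' h₄'

namespace SweepsOut

variable {P : Finset Plane} {θ φ : ℝ} {m m' : WithTop ℝ} {k l : ℕ} {p q : ℕ → Plane}

/-- No halving edge at the vertex `p (i + 1)` is strictly between the edges before and after it. -/
theorem gap (hp : SweepsOut P θ m k p) {i : ℕ} (hi : i + 1 < k) (u : Plane)
    (hu : IsHalving P (p (i + 1)) u)
    (h : slopeAt θ (p (i + 1)) u < slopeAt θ (p i) (p (i + 1))) :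
    slopeAt θ (p (i + 1)) u ≤ slopeAt θ (p (i + 1)) (p (i + 2)) :=
  (hp.next (i + 1) hi).2.2 u hu (WithTop.coe_lt_coe.2 h)

/-- Two chains, possibly for different orientations, that share an edge go on in the same way. -/
theorem succ_eq (hP : GeneralPosition P) (hp : SweepsOut P θ m k p) (hq : SweepsOut P φ m' l q)
    {i j : ℕ} (hi : i + 1 < k) (hj : j + 1 < l) (h₀ : p i = q j) (h₁ : p (i + 1) = q (j + 1)) :
    p (i + 2) = q (j + 2) := by
  have a1 := hp.halving hi
  have a2 := hp.lt i (by omega)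
  have a3 := hp.lt _ hi
  have a4 := hp.slope_lt (Nat.lt_succ_self i) hi
  have a5 := hp.gap hi
  have b1 := hq.halving hj
  have b2 := hq.lt j (by omega)
  have b3 := hq.lt _ hj
  have b4 := hq.slope_lt (Nat.lt_succ_self j) hj
  have b5 := hq.gap hj
  rw [← h₀, ← h₁] at b2 b4 b5
  rw [← h₁] at b1 b3
  exact eq_of_next_right hP a1 b1 a2 b2 a3 b3 a4 b4 a5 b5

/-- Two chains, possibly for different orientations, that share an edge arrive there in the same
way. -/
theorem pred_eq (hP : GeneralPosition P) (hp : SweepsOut P θ m k p) (hq : SweepsOut P φ m' l q)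
    {i j : ℕ} (hi : i + 1 < k) (hj : j + 1 < l) (h₁ : p (i + 1) = q (j + 1))
    (h₂ : p (i + 2) = q (j + 2)) : p i = q j := by
  have a1 := (hp.halving (show i < k by omega)).symm
  have a2 := hp.lt i (by omega)
  have a3 := hp.lt _ hi
  have a4 := hp.slope_lt (Nat.lt_succ_self i) hi
  have a5 := hp.gap hi
  have b1 := (hq.halving (show j < l by omega)).symm
  have b2 := hq.lt j (by omega)
  have b3 := hq.lt _ hj
  have b4 := hq.slope_lt (Nat.lt_succ_self j) hj
  have b5 := hq.gap hj
  simp only [Nat.succ_eq_add_one, add_assoc, one_add_one_eq_two] at *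
  rw [← h₂, ← h₁] at b3 b4 b5
  rw [← h₁] at b1 b2
  exact eq_of_next_left hP a1 b1 a3 b3 a2 b2 a4 b4 a5 b5

/-- The common edge is propagated to both sides; neither chain can start or stop in the middle of
the other. -/
theorem exists_vertex_eq (hP : GeneralPosition P) (hp : SweepsOut P θ ⊤ k p)
    (hq : SweepsOut P θ ⊤ l q) {i j : ℕ} (hi : i < k) (hj : j < l) (h₀ : p i = q j)
    (h₁ : p (i + 1) = q (j + 1)) {t : ℕ} (ht : t ≤ k) : ∃ s ≤ l, q s = p t := by
  rcases Nat.lt_or_ge t (i + 1) with h | h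
  · have H : ∀ d ≤ i, ∃ s < l, q s = p (i - d) ∧ q (s + 1) = p (i - d + 1) := by
      intro d
      induction d with
      | zero => exact fun _ => ⟨j, hj, h₀.symm, h₁.symm⟩
      | succ d ih =>
        intro hd
        obtain ⟨s, hs, e1, e2⟩ := ih (by omega)
        obtain ⟨r, hr⟩ : ∃ r, i - d = r + 1 := ⟨i - d - 1, by omega⟩
        have hr' : i - (d + 1) = r := by omega
        rw [hr] at e1 e2
        rw [hr']
        rcases s with _ | s
        -- If `q` started here, its rotation from the vertical would have met the steeper edge from
        -- `p r` first.
        · have a1 := (hp.halving (show r < k by omega)).symm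
          have a2 := hp.slope_lt (Nat.lt_succ_self r) (show r + 1 < k by omega)
          have a3 := (hq.next 0 hs).2.2 (p r)
          rw [zero_add] at *
          rw [e1, e2, slopeAt_comm θ _ (p r)] at a3
          exact absurd (a3 a1 (WithTop.coe_lt_top _)) (not_le.2 a2)
        · exact ⟨s, by omega, (hp.pred_eq hP hq (i := r) (j := s) (by omega) hs
            e1.symm e2.symm).symm, e1⟩
    obtain ⟨s, hs, e, -⟩ := H (i - t) (by omega)
    exact ⟨s, hs.le, by rw [e]; congr 1; omega⟩
  · have H : ∀ t, i + 1 ≤ t → t ≤ k → ∃ s < l, q s = p (t - 1) ∧ q (s + 1) = p t := by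
      intro t h
      induction t, h using Nat.le_induction with
      | base => exact fun _ => ⟨j, hj, h₀.symm, h₁.symm⟩
      | succ t hit ih =>
        intro ht
        obtain ⟨s, hs, e1, e2⟩ := ih (by omega)
        obtain ⟨r, rfl⟩ : ∃ r, t = r + 1 := ⟨t - 1, by omega⟩
        rw [Nat.add_sub_cancel] at e1
        rcases Nat.lt_or_ge (s + 1) l with hs' | hs'
        · exact ⟨s + 1, hs', e2, (hp.succ_eq hP hq (i := r) (by omega) hs' e1.symm e2.symm).symm⟩
        · obtain rfl : l = s + 1 := by omega
          -- If `q` stopped here, the next edge of `p` would contradict `last`.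
          have a1 := hp.halving (show r + 1 < k by omega)
          have a2 := hp.slope_lt (Nat.lt_succ_self r) (show r + 1 < k by omega)
          have a3 := hq.last (p (r + 1 + 1))
          rw [inSlope, e1, e2] at a3
          exact absurd (WithTop.coe_lt_coe.2 a2) (a3 a1)
    obtain ⟨s, hs, -, e⟩ := H t h ht
    exact ⟨s + 1, hs, e⟩

end SweepsOut

/-! ### The charged tangent exists. -/

theorem yc_ne_lineAt {P : Finset Plane} (hP : GeneralPosition P) {θ : ℝ}
    {a b v : Plane} (ha : a ∈ P) (hb : b ∈ P) (hv : v ∈ P)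
    (hab : xc θ a < xc θ b) (hva : v ≠ a) (hvb : v ≠ b) :
    yc θ v ≠ lineAt θ a b (xc θ v) := by
  intro h
  apply orient_ne_zero hP ha hb hv (by rintro rfl; exact lt_irrefl _ hab) hva.symm hvb.symm
  rw [orient_eq_cross, cross_eq θ]
  have := sub_ne_zero.2 hab.ne'
  unfold lineAt slopeAt at h
  rw [h]
  field_simp
  ring

/-- The edge of the upper hull of `V` over `x`. -/
theorem exists_hull_edge {P V : Finset Plane} (hP : GeneralPosition P) {θ : ℝ} {x : ℝ}
    (hV : V ⊆ P) (h₁ : ∃ v ∈ V, xc θ v < x) (h₂ : ∃ v ∈ V, x < xc θ v)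
    (h₃ : ∀ v ∈ V, xc θ v ≠ x) :
    ∃ a ∈ V, ∃ b ∈ V, xc θ a < x ∧ x < xc θ b ∧
      ∀ v ∈ V, v ≠ a → v ≠ b → StrictlyBelow θ a b v := by
  classical
  obtain ⟨v, hv, hvx⟩ := h₁
  obtain ⟨w, hw, hwx⟩ := h₂
  -- Among the segments of `V` that straddle `x`, take the highest over `x`. A vertex above its line
  -- could replace the endpoint on the same side of `x` and raise it.
  obtain ⟨⟨a, b⟩, hab, hmax⟩ := Finset.exists_max_image
    ((V.filter fun v => xc θ v < x) ×ˢ (V.filter fun v => x < xc θ v))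
    (fun c => lineAt θ c.1 c.2 x)
    ⟨(v, w), by simp [*]⟩
  simp only [Finset.mem_product, Finset.mem_filter] at hab hmax
  obtain ⟨⟨ha, hax⟩, hb, hbx⟩ := hab
  refine ⟨a, ha, b, hb, hax, hbx, fun v hv hva hvb => ?_⟩
  rw [strictlyBelow_iff]
  by_contra hc
  have hc : lineAt θ a b (xc θ v) < yc θ v := lt_of_le_of_ne (not_lt.1 hc)
    (yc_ne_lineAt hP (hV ha) (hV hb) (hV hv) (hax.trans hbx) hva hvb).symm
  rcases lt_or_gt_of_ne (h₃ v hv) with hvx | hvx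
  · have h := hmax (v, b) ⟨⟨hv, hvx⟩, hb, hbx⟩
    have e1 := lineAt_mul θ a b (xc θ v) (xc θ b) x
    have e2 := lineAt_mul θ v b (xc θ v) (xc θ b) x
    rw [lineAt_right (hax.trans hbx).ne] at e1
    rw [lineAt_right (hvx.trans hbx).ne, lineAt_left] at e2
    have := mul_lt_mul_of_pos_left hc (sub_pos.2 hbx)
    have := mul_le_mul_of_nonneg_right h (sub_pos.2 (hvx.trans hbx)).le
    dsimp only at this
    linarith
  · have h := hmax (a, v) ⟨⟨ha, hax⟩, hv, hvx⟩
    have e1 := lineAt_mul θ a b (xc θ a) (xc θ v) x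
    have e2 := lineAt_mul θ a v (xc θ a) (xc θ v) x
    rw [lineAt_left] at e1
    rw [lineAt_right (hax.trans hvx).ne, lineAt_left] at e2
    have := mul_lt_mul_of_pos_left hc (sub_pos.2 hax)
    have := mul_le_mul_of_nonneg_right h (sub_pos.2 (hax.trans hvx)).le
    dsimp only at this
    linarith

theorem mem_vertices_iff {S : List (Sym2 Plane)} {k : ℕ} {p : ℕ → Plane}
    (h : ∀ e, e ∈ S ↔ ∃ i < k, e = s(p i, p (i + 1))) (hk : 0 < k) {v : Plane} :
    v ∈ vertices S ↔ ∃ t ≤ k, p t = v := by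
  constructor
  · rintro ⟨e, he, hv⟩
    obtain ⟨i, hi, rfl⟩ := (h e).1 he
    rcases Sym2.mem_iff.1 hv with rfl | rfl
    · exact ⟨i, hi.le, rfl⟩
    · exact ⟨i + 1, hi, rfl⟩
  · rintro ⟨t, ht, rfl⟩
    rcases t with _ | t
    · exact ⟨_, (h _).2 ⟨0, hk, rfl⟩, by simp⟩
    · exact ⟨_, (h _).2 ⟨t, ht, rfl⟩, by simp⟩

theorem StrictlyBelow.symm {θ : ℝ} {a b v : Plane} (hab : xc θ a ≠ xc θ b)
    (h : StrictlyBelow θ a b v) : StrictlyBelow θ b a v := by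
  rw [strictlyBelow_iff] at h ⊢
  rw [lineAt_sub θ a b (xc θ b), lineAt_right hab, slopeAt_comm] at h
  exact h

theorem xc_mem_segment {θ : ℝ} {a b q : Plane} (hq : q ∈ segment ℝ a b)
    (h : xc θ a < xc θ b) : xc θ a ≤ xc θ q ∧ xc θ q ≤ xc θ b := by
  obtain ⟨s, t, hs, ht, hst, rfl⟩ := hq
  have e : xc θ (s • a + t • b) = s * xc θ a + t * xc θ b := by
    unfold xc; simp; ring
  obtain rfl : s = 1 - t := by linarith
  rw [e]
  constructor <;> nlinarith

theorem exists_mem_segment {θ x : ℝ} {a b : Plane} (ha : xc θ a < x) (hb : x < xc θ b) :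
    ∃ q ∈ segment ℝ a b, xc θ q = x := by
  have h : xc θ b - xc θ a ≠ 0 := by linarith
  have h' : 0 < xc θ b - xc θ a := by linarith
  refine ⟨(1 - (x - xc θ a) / (xc θ b - xc θ a)) • a + ((x - xc θ a) / (xc θ b - xc θ a)) • b,
    ⟨_, _, ?_, ?_, by ring, rfl⟩, ?_⟩
  · rw [sub_nonneg, div_le_one h']; linarith
  · exact div_nonneg (by linarith) h'.le
  · have e : ∀ t : ℝ, xc θ ((1 - t) • a + t • b) = xc θ a + t * (xc θ b - xc θ a) := by
      intro t; unfold xc; simp; ring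
    rw [e]; field_simp; ring

/-- The chains, the crossing point and the tangent behind a charged pair. -/
theorem IsCharged.exists_tangentOver {P : Finset Plane} {θ : ℝ} (hn : Even P.card)
    (hP : GeneralPosition P) (hθ : IsOrientation P θ) {C : Sym2 (Sym2 Plane)}
    (hC : IsCrossing P C) {r : Sym2 Plane} (h : IsCharged P θ C r) :
    ∃ k p l q i j i₀ j₀ z, TangentOver P θ k p l q i j i₀ j₀ z ∧
      C = s(s(p i, p (i + 1)), s(q j, q (j + 1))) ∧ r = s(p i₀, q j₀) := by
  -- The case in which the vertex on the first chain is the left one; otherwise the two chains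
  -- exchange roles.
  have aux : ∀ e f S T a b z, e ≠ f → IsChain P θ S → IsChain P θ T → e ∈ S → f ∈ T →
      z ∈ edgeInterior e → z ∈ edgeInterior f → a ∈ vertices S → b ∈ vertices T →
      (∀ v ∈ vertices S ∪ vertices T, v ≠ a → v ≠ b → StrictlyBelow θ a b v) →
      xc θ a < xc θ b → xc θ a ≤ xc θ z → xc θ z ≤ xc θ b →
      ∃ k p l q i j i₀ j₀ z, TangentOver P θ k p l q i j i₀ j₀ z ∧
        s(e, f) = s(s(p i, p (i + 1)), s(q j, q (j + 1))) ∧ s(a, b) = s(p i₀, q j₀) := by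
    intro e f S T a b z hef hS hT he hf hze hzf ha hb hbelow hab haz hzb
    obtain ⟨k, p, hp, hpS⟩ := hS.exists_sweepsOut hn hP hθ
    obtain ⟨l, q, hq, hqT⟩ := hT.exists_sweepsOut hn hP hθ
    obtain ⟨i, hi, rfl⟩ := (hpS e).1 he
    obtain ⟨j, hj, rfl⟩ := (hqT f).1 hf
    simp only [Set.mem_union, mem_vertices_iff hpS (Nat.zero_lt_of_lt hi),
      mem_vertices_iff hqT (Nat.zero_lt_of_lt hj)] at ha hb hbelow
    obtain ⟨i₀, hi₀, rfl⟩ := ha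
    obtain ⟨j₀, hj₀, rfl⟩ := hb
    rw [edgeInterior_mk] at hze hzf
    obtain ⟨p1, p2⟩ := xc_lt_of_mem_openSegment hze (hp.lt i hi)
    obtain ⟨q1, q2⟩ := xc_lt_of_mem_openSegment hzf (hq.lt j hj)
    exact ⟨k, p, l, q, i, j, i₀, j₀, z, ⟨hp, hq, hi, hj, hi₀, hj₀, hef, hze, hzf,
      lt_of_le_of_ne haz (hp.xc_ne hi hi₀ p1 p2), lt_of_le_of_ne hzb (hq.xc_ne hj hj₀ q1 q2).symm,
      fun t ht => hbelow _ (Or.inl ⟨t, ht, rfl⟩), fun t ht => hbelow _ (Or.inr ⟨t, ht, rfl⟩)⟩,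
      rfl, rfl⟩
  have mem : ∀ {S a}, IsChain P θ S → a ∈ vertices S → a ∈ P := by
    rintro S a hS ⟨e, he, ha⟩
    obtain ⟨k, p, hp, hpS⟩ := hS.exists_sweepsOut hn hP hθ
    obtain ⟨i, hi, rfl⟩ := (hpS e).1 he
    rcases Sym2.mem_iff.1 ha with rfl | rfl
    · exact hp.mem i hi.le
    · exact hp.mem (i + 1) hi
  obtain ⟨e, f, S, T, a, b, z, rfl, rfl, hS, hT, he, hf, ⟨hze, hzf⟩, ⟨ha, hb, hab, hbelow⟩,
    q, hq, hqz⟩ := h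
  have hef : e ≠ f := by
    obtain ⟨e', f', h, hne, -⟩ := hC
    rcases Sym2.eq_iff.1 h with ⟨rfl, rfl⟩ | ⟨rfl, rfl⟩
    · exact hne
    · exact hne.symm
  have hx := hθ.ne (mem hS ha) (mem hT hb) hab
  rcases lt_or_gt_of_ne hx with h | h
  · obtain ⟨h1, h2⟩ := xc_mem_segment hq h
    rw [hqz] at h1 h2
    exact aux e f S T a b z hef hS hT he hf hze hzf ha hb hbelow h h1 h2
  · rw [segment_symm] at hq
    obtain ⟨h1, h2⟩ := xc_mem_segment hq h
    rw [hqz] at h1 h2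
    rw [Sym2.eq_swap (a := e), Sym2.eq_swap (a := a)]
    exact aux f e T S b a z hef.symm hT hS hf he hzf hze hb ha
      (fun v hv h1 h2 => (hbelow v hv.symm h2 h1).symm hx) h h1 h2

/-- Every crossing is charged a pair of vertices. -/
theorem IsCrossing.exists_isCharged {P : Finset Plane} {θ : ℝ} (hn : Even P.card)
    (hP : GeneralPosition P) (hθ : IsOrientation P θ) {C : Sym2 (Sym2 Plane)}
    (hC : IsCrossing P C) : ∃ r, IsCharged P θ C r := by
  classical
  obtain ⟨e, f, rfl, hef, he, hf, z, hze, hzf⟩ := hC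
  have chain : ∀ e ∈ (underlyingGraph P).edgeSet, ∃ S, IsChain P θ S ∧ e ∈ S := by
    intro e
    induction e using Sym2.ind with
    | _ v w => exact fun he => exists_isChain hn hP hθ (isHalving_of_mem_edgeSet he rfl)
  obtain ⟨S, hS, heS⟩ := chain e he
  obtain ⟨T, hT, hfT⟩ := chain f hf
  obtain ⟨k, p, hp, hpS⟩ := hS.exists_sweepsOut hn hP hθ
  obtain ⟨l, q, hq, hqT⟩ := hT.exists_sweepsOut hn hP hθ
  obtain ⟨i, hi, rfl⟩ := (hpS e).1 heS
  obtain ⟨j, hj, rfl⟩ := (hqT f).1 hfT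
  have vS := fun v => mem_vertices_iff hpS (Nat.zero_lt_of_lt hi) (v := v)
  have vT := fun v => mem_vertices_iff hqT (Nat.zero_lt_of_lt hj) (v := v)
  have hze' := hze
  have hzf' := hzf
  rw [edgeInterior_mk] at hze hzf
  obtain ⟨p1, p2⟩ := xc_lt_of_mem_openSegment hze (hp.lt i hi)
  obtain ⟨q1, q2⟩ := xc_lt_of_mem_openSegment hzf (hq.lt j hj)
  have yp := yc_of_mem_openSegment hze (hp.lt i hi)
  have yq := yc_of_mem_openSegment hzf (hq.lt j hj)
  set V : Finset Plane := (Finset.range (k + 1)).image p ∪ (Finset.range (l + 1)).image q with hV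
  have memV : ∀ v, v ∈ V ↔ (∃ t ≤ k, p t = v) ∨ ∃ t ≤ l, q t = v := by
    intro v
    simp only [hV, Finset.mem_union, Finset.mem_image, Finset.mem_range, Nat.lt_succ_iff]
  obtain ⟨a, ha, b, hb, hax, hbx, hbelow⟩ := exists_hull_edge (V := V) (x := xc θ z) hP
    (fun v hv => by
      rcases (memV v).1 hv with ⟨t, ht, rfl⟩ | ⟨t, ht, rfl⟩
      exacts [hp.mem t ht, hq.mem t ht])
    ⟨p i, (memV _).2 (Or.inl ⟨i, hi.le, rfl⟩), p1⟩
    ⟨p (i + 1), (memV _).2 (Or.inl ⟨i + 1, hi, rfl⟩), p2⟩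
    (fun v hv => by
      rcases (memV v).1 hv with ⟨t, ht, rfl⟩ | ⟨t, ht, rfl⟩
      exacts [hp.xc_ne hi ht p1 p2, hq.xc_ne hj ht q1 q2])
  have hab : a ≠ b := by rintro rfl; exact lt_asymm hax hbx
  -- If the hull edge did not pass strictly above `z`, both crossing edges would coincide with it.
  have hz : ¬ lineAt θ a b (xc θ z) ≤ yc θ z := by
    intro h
    obtain ⟨e1, e2⟩ := eq_of_lineAt_le hax hbx p1 p2
      (hbelow _ ((memV _).2 (Or.inl ⟨i, hi.le, rfl⟩)))
      (hbelow _ ((memV _).2 (Or.inl ⟨i + 1, hi, rfl⟩))) (yp ▸ h)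
    obtain ⟨e3, e4⟩ := eq_of_lineAt_le hax hbx q1 q2
      (hbelow _ ((memV _).2 (Or.inr ⟨j, hj.le, rfl⟩)))
      (hbelow _ ((memV _).2 (Or.inr ⟨j + 1, hj, rfl⟩))) (yq ▸ h)
    exact hef (by rw [e1, e2, e3, e4])
  have seg := exists_mem_segment hax hbx
  have below : ∀ v, v ∈ vertices S ∨ v ∈ vertices T → v ≠ a → v ≠ b → StrictlyBelow θ a b v :=
    fun v hv => hbelow v ((memV v).2 (by rwa [vS, vT] at hv))
  -- Two ends on the same chain would make the hull edge a chord, which is not above `z`.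
  rcases (memV a).1 ha with ha | ha <;> rcases (memV b).1 hb with hb | hb
  · obtain ⟨s, hs, rfl⟩ := ha
    obtain ⟨t, ht, rfl⟩ := hb
    exact absurd (yp ▸ hp.lineAt_le hi hs ht hax hbx) hz
  · exact ⟨s(a, b), _, _, S, T, a, b, z, rfl, rfl, hS, hT, heS, hfT, ⟨hze', hzf'⟩,
      ⟨(vS a).2 ha, (vT b).2 hb, hab, below⟩, seg⟩
  · exact ⟨s(a, b), _, _, T, S, a, b, z, Sym2.eq_swap, rfl, hT, hS, hfT, heS, ⟨hzf', hze'⟩,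
      ⟨(vT a).2 ha, (vS b).2 hb, hab, fun v hv => below v hv.symm⟩, seg⟩
  · obtain ⟨s, hs, rfl⟩ := ha
    obtain ⟨t, ht, rfl⟩ := hb
    exact absurd (yq ▸ hq.lineAt_le hj hs ht hax hbx) hz

/-! ### The charged tangent is unique. -/

/-- Two halving edges cross at only one point. -/
theorem xc_crossing_unique {P : Finset Plane} (hP : GeneralPosition P) {θ : ℝ} {a b c d z z' : Plane}
    (ha : a ∈ P) (hb : b ∈ P) (hc : c ∈ P) (hd : d ∈ P) (hab : xc θ a < xc θ b)
    (hcd : xc θ c < xc θ d) (hne : s(a, b) ≠ s(c, d)) (h₁ : z ∈ openSegment ℝ a b)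
    (h₂ : z ∈ openSegment ℝ c d) (h₁' : z' ∈ openSegment ℝ a b) (h₂' : z' ∈ openSegment ℝ c d) :
    xc θ z = xc θ z' := by
  by_contra hx
  have e := (yc_of_mem_openSegment h₁ hab).symm.trans (yc_of_mem_openSegment h₂ hcd)
  have e' := (yc_of_mem_openSegment h₁' hab).symm.trans (yc_of_mem_openSegment h₂' hcd)
  have hs : slopeAt θ a b = slopeAt θ c d := by
    rw [lineAt_sub θ a b (xc θ z), lineAt_sub θ c d (xc θ z), e] at e'
    exact mul_right_cancel₀ (sub_ne_zero.2 (Ne.symm hx)) (add_left_cancel e')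
  have hl : ∀ x, lineAt θ a b x = lineAt θ c d x := by
    intro x
    rw [lineAt_sub θ a b (xc θ z), lineAt_sub θ c d (xc θ z), e, hs]
  obtain ⟨a1, a2⟩ := xc_lt_of_mem_openSegment h₁ hab
  obtain ⟨c1, c2⟩ := xc_lt_of_mem_openSegment h₂ hcd
  have e1 : c = a := by
    by_contra h
    refine yc_ne_lineAt hP ha hb hc hab h ?_ (by rw [hl, lineAt_left])
    rintro rfl
    exact lt_asymm c1 a2
  have e2 : d = b := by
    by_contra h
    refine yc_ne_lineAt hP ha hb hd hab ?_ h (by rw [hl, lineAt_right hcd.ne])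
    rintro rfl
    exact lt_asymm c2 a1
  exact hne (by rw [e1, e2])

/-- Both tangents are hull edges of the same set over the same abscissa. The one that is at least as
high there still has its ends below or on the other, so they coincide. -/
theorem TangentOver.pair_eq {P : Finset Plane} {θ : ℝ} {k l i j i₀ j₀ k' l' i' j' i₀' j₀' : ℕ}
    {p q p' q' : ℕ → Plane} {z z' : Plane} (h : TangentOver P θ k p l q i j i₀ j₀ z)
    (h' : TangentOver P θ k' p' l' q' i' j' i₀' j₀' z') (hx : xc θ z = xc θ z')
    (hV : ∀ v, ((∃ t ≤ k, p t = v) ∨ ∃ t ≤ l, q t = v) ↔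
      ((∃ t ≤ k', p' t = v) ∨ ∃ t ≤ l', q' t = v)) :
    s(p i₀, q j₀) = s(p' i₀', q' j₀') := by
  have b : ∀ v, ((∃ t ≤ k, p t = v) ∨ ∃ t ≤ l, q t = v) → v ≠ p i₀ → v ≠ q j₀ →
      StrictlyBelow θ (p i₀) (q j₀) v := by
    rintro v (⟨t, ht, rfl⟩ | ⟨t, ht, rfl⟩)
    exacts [h.below_p t ht, h.below_q t ht]
  have b' : ∀ v, ((∃ t ≤ k', p' t = v) ∨ ∃ t ≤ l', q' t = v) → v ≠ p' i₀' → v ≠ q' j₀' →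
      StrictlyBelow θ (p' i₀') (q' j₀') v := by
    rintro v (⟨t, ht, rfl⟩ | ⟨t, ht, rfl⟩)
    exacts [h'.below_p t ht, h'.below_q t ht]
  have x1 := h'.lt_z
  have x2 := h'.z_lt
  rw [← hx] at x1 x2
  rcases le_total (lineAt θ (p i₀) (q j₀) (xc θ z)) (lineAt θ (p' i₀') (q' j₀') (xc θ z))
    with hl | hl
  · obtain ⟨e1, e2⟩ := eq_of_lineAt_le h.lt_z h.z_lt x1 x2
      (b _ ((hV _).2 (Or.inl ⟨_, h'.hi₀, rfl⟩))) (b _ ((hV _).2 (Or.inr ⟨_, h'.hj₀, rfl⟩))) hl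
    rw [e1, e2]
  · obtain ⟨e1, e2⟩ := eq_of_lineAt_le x1 x2 h.lt_z h.z_lt
      (b' _ ((hV _).1 (Or.inl ⟨_, h.hi₀, rfl⟩))) (b' _ ((hV _).1 (Or.inr ⟨_, h.hj₀, rfl⟩))) hl
    rw [e1, e2]

/-- This makes the tangent independent of which chains through the crossing edges are chosen. -/
theorem SweepsOut.range_eq {P : Finset Plane} (hP : GeneralPosition P) {θ : ℝ} {k l i j : ℕ}
    {p q : ℕ → Plane} (hp : SweepsOut P θ ⊤ k p) (hq : SweepsOut P θ ⊤ l q) (hi : i < k)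
    (hj : j < l) (h : s(p i, p (i + 1)) = s(q j, q (j + 1))) :
    (p i = q j ∧ p (i + 1) = q (j + 1)) ∧ ∀ v, (∃ t ≤ k, p t = v) ↔ ∃ t ≤ l, q t = v := by
  have e : p i = q j ∧ p (i + 1) = q (j + 1) := by
    rcases Sym2.eq_iff.1 h with h | ⟨h1, h2⟩
    · exact h
    · have a1 := hp.lt i hi
      have a2 := hq.lt j hj
      rw [h1, h2] at a1
      exact absurd a1 (lt_asymm a2)
  refine ⟨e, fun v => ⟨?_, ?_⟩⟩
  · rintro ⟨t, ht, rfl⟩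
    exact hp.exists_vertex_eq hP hq hi hj e.1 e.2 ht
  · rintro ⟨t, ht, rfl⟩
    exact hq.exists_vertex_eq hP hp hj hi e.1.symm e.2.symm ht

/-- No crossing is charged two pairs of vertices. -/
theorem IsCharged.unique {P : Finset Plane} {θ : ℝ} (hn : Even P.card)
    (hP : GeneralPosition P) (hθ : IsOrientation P θ) {C : Sym2 (Sym2 Plane)}
    (hC : IsCrossing P C) {r r' : Sym2 Plane} (h : IsCharged P θ C r) (h' : IsCharged P θ C r') :
    r = r' := by
  obtain ⟨k, p, l, q, i, j, i₀, j₀, z, H, e1, rfl⟩ := h.exists_tangentOver hn hP hθ hC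
  obtain ⟨k', p', l', q', i', j', i₀', j₀', z', H', e2, rfl⟩ := h'.exists_tangentOver hn hP hθ hC
  rw [e1] at e2
  rcases Sym2.eq_iff.1 e2 with ⟨f1, f2⟩ | ⟨f1, f2⟩
  · obtain ⟨⟨g1, g2⟩, g3⟩ := H.hp.range_eq hP H'.hp H.hi H'.hi f1
    obtain ⟨⟨g4, g5⟩, g6⟩ := H.hq.range_eq hP H'.hq H.hj H'.hj f2
    have zp := H'.zp
    have zq := H'.zq
    rw [← g1, ← g2] at zp
    rw [← g4, ← g5] at zq
    exact H.pair_eq H' (xc_crossing_unique hP (H.hp.mem _ H.hi.le) (H.hp.mem _ H.hi)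
      (H.hq.mem _ H.hj.le) (H.hq.mem _ H.hj) (H.hp.lt _ H.hi) (H.hq.lt _ H.hj) H.ne
      H.zp H.zq zp zq) (fun v => or_congr (g3 v) (g6 v))
  · obtain ⟨⟨g1, g2⟩, g3⟩ := H.hp.range_eq hP H'.hq H.hi H'.hj f1
    obtain ⟨⟨g4, g5⟩, g6⟩ := H.hq.range_eq hP H'.hp H.hj H'.hi f2
    have zp := H'.zq
    have zq := H'.zp
    rw [← g1, ← g2] at zp
    rw [← g4, ← g5] at zq
    exact H.pair_eq H' (xc_crossing_unique hP (H.hp.mem _ H.hi.le) (H.hp.mem _ H.hi)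
      (H.hq.mem _ H.hj.le) (H.hq.mem _ H.hj) (H.hp.lt _ H.hi) (H.hq.lt _ H.hj) H.ne
      H.zp H.zq zp zq) (fun v => (or_congr (g3 v) (g6 v)).trans or_comm)

/-! ### Comparing two orientations with the same tangent. -/

theorem StrictlyBelow.slope_right {θ : ℝ} {a b v : Plane} (h : StrictlyBelow θ a b v)
    (hv : xc θ a < xc θ v) : slopeAt θ a v < slopeAt θ a b := by
  unfold StrictlyBelow at h
  rw [slopeAt, div_lt_iff₀ (sub_pos.2 hv)]
  linarith

theorem StrictlyBelow.slope_left {θ : ℝ} {a b v : Plane} (h : StrictlyBelow θ a b v)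
    (hv : xc θ v < xc θ a) : slopeAt θ a b < slopeAt θ v a := by
  unfold StrictlyBelow at h
  have e : slopeAt θ v a = (yc θ a - yc θ v) / (xc θ a - xc θ v) := rfl
  rw [e, lt_div_iff₀ (sub_pos.2 hv)]
  linarith

theorem orient_mem_openSegment {a b c d z : Plane} (hz : z ∈ openSegment ℝ c d)
    (h : orient a b d < orient a b c) : orient a b d < orient a b z ∧ orient a b z < orient a b c := by
  obtain ⟨s, h0, h1, e⟩ := exists_of_mem_openSegment hz
  have e : orient a b z = orient a b c + s * (orient a b d - orient a b c) := by
    unfold orient; rw [e, e]; ring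
  rw [e]
  constructor <;> nlinarith

namespace TangentOver

variable {P : Finset Plane} {θ φ : ℝ} {k l i j i₀ j₀ k' l' i' j' i₀' j₀' : ℕ}
  {p q p' q' : ℕ → Plane} {z z' : Plane}

theorem lt (h : TangentOver P θ k p l q i j i₀ j₀ z) : xc θ (p i₀) < xc θ (q j₀) :=
  h.lt_z.trans h.z_lt

theorem i₀_le (h : TangentOver P θ k p l q i j i₀ j₀ z) : i₀ ≤ i :=
  Nat.lt_succ_iff.1 (h.hp.lt_of_xc_lt h.hi₀ (h.lt_z.trans h.p_lt))

theorem lt_j₀ (h : TangentOver P θ k p l q i j i₀ j₀ z) : j < j₀ :=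
  h.hq.lt_of_xc_lt h.hj.le (h.lt_q.trans h.z_lt)

theorem slope_succ_lt (h : TangentOver P θ k p l q i j i₀ j₀ z) :
    slopeAt θ (p i₀) (p (i₀ + 1)) < slopeAt θ (p i₀) (q j₀) := by
  have hk : i₀ < k := h.i₀_le.trans_lt h.hi
  have hx := h.hp.lt i₀ hk
  exact (h.below_p _ hk (fun e => hx.ne (by rw [e])) (h.p_ne hk)).slope_right hx

/-- With `slope_succ_lt`, the rotation about `p i₀` passes the direction of the tangent before it
collects the next edge. -/
theorem slope_lt_inSlope (h : TangentOver P θ k p l q i j i₀ j₀ z) :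
    (slopeAt θ (p i₀) (q j₀) : WithTop ℝ) < inSlope θ ⊤ p i₀ := by
  rcases i₀ with _ | r
  · exact WithTop.coe_lt_top _
  · have hr : r < k := h.hi₀
    have hx := h.hp.lt r hr
    exact WithTop.coe_lt_coe.2
      ((h.below_p _ hr.le (fun e => hx.ne (by rw [e])) (h.p_ne hr.le)).slope_left hx)

theorem gap_p (h : TangentOver P θ k p l q i j i₀ j₀ z) (u : Plane) (hu : IsHalving P (p i₀) u)
    (hs : (slopeAt θ (p i₀) u : WithTop ℝ) < inSlope θ ⊤ p i₀) :
    slopeAt θ (p i₀) u ≤ slopeAt θ (p i₀) (p (i₀ + 1)) :=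
  (h.hp.next i₀ (h.i₀_le.trans_lt h.hi)).2.2 u hu hs

theorem slope_lt_pred {r : ℕ} (h : TangentOver P θ k p l q i j i₀ (r + 1) z) :
    slopeAt θ (p i₀) (q (r + 1)) < slopeAt θ (q r) (q (r + 1)) := by
  have hr : r < l := h.hj₀
  have hx := h.hq.lt r hr
  rw [slopeAt_comm]
  exact ((h.below_q _ hr.le (h.q_ne hr.le) (fun e => hx.ne (by rw [e]))).symm
    h.lt.ne).slope_left hx

/-- Seen backwards at the right vertex, no halving edge lies between the tangent and the incoming
edge. If the chain ends there, this is `last`; otherwise the outgoing edge is already less steep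
than the tangent. -/
theorem gap_q {r : ℕ} (h : TangentOver P θ k p l q i j i₀ (r + 1) z) (u : Plane)
    (hu : IsHalving P (q (r + 1)) u)
    (hs : slopeAt θ (q (r + 1)) u < slopeAt θ (q r) (q (r + 1))) :
    slopeAt θ (q (r + 1)) u ≤ slopeAt θ (p i₀) (q (r + 1)) := by
  rcases h.hj₀.lt_or_eq with hl | rfl
  · have hx := h.hq.lt _ hl
    have h1 := ((h.below_q _ hl (h.q_ne hl) (fun e => hx.ne (by rw [e]))).symm
      h.lt.ne).slope_right hx
    rw [slopeAt_comm θ (p i₀)]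
    exact ((h.hq.gap hl u hu hs).trans_lt h1).le
  · exact absurd (WithTop.coe_lt_coe.2 hs) (h.hq.last u hu)

open Classical in
/-- The upper side of a common tangent contains fewer points of `P` than the lower side. -/
theorem card_lt (hn : Even P.card) (hP : GeneralPosition P) (hθ : IsOrientation P θ)
    (h : TangentOver P θ k p l q i j i₀ j₀ z) :
    (P.filter fun c => 0 < orient (p i₀) (q j₀) c).card <
      (P.filter fun c => orient (p i₀) (q j₀) c < 0).card := by
  have ha := h.hp.mem _ h.hi₀
  have hb := h.hq.mem _ h.hj₀
  -- No halving edge is met before the line reaches the tangent, so fewer than half of the points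
  -- are still above it.
  have h1 := (cnt_iff_of_gap hn hP hθ ha h.slope_lt_inSlope fun u hu h1 h2 =>
    absurd ((h.gap_p u hu h2).trans_lt h.slope_succ_lt) (not_lt_of_gt h1)).1 (h.hp.low _ h.hi₀)
  rw [cntBefore_of_right hP hθ ha hb h.lt] at h1
  have hne : p i₀ ≠ q j₀ := h.p_ne h.hi₀
  have h2 := card_pos_add_card_neg hP ha hb hne
  -- Equal sides would make the tangent a halving edge, collected before `p (i₀ + 1)`.
  have h3 : (P.filter fun c => 0 < orient (p i₀) (q j₀) c).card ≠
      (P.filter fun c => orient (p i₀) (q j₀) c < 0).card := fun h3 =>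
    absurd (h.gap_p (q j₀) ⟨ha, hb, hne, h3⟩ h.slope_lt_inSlope) (not_le.2 h.slope_succ_lt)
  obtain ⟨r, hr⟩ := hn
  omega

/-- The upper side of a tangent does not depend on the orientation. -/
theorem eq_of_pair_eq (hn : Even P.card) (hP : GeneralPosition P) (hθ : IsOrientation P θ)
    (hφ : IsOrientation P φ) (h : TangentOver P θ k p l q i j i₀ j₀ z)
    (h' : TangentOver P φ k' p' l' q' i' j' i₀' j₀' z') (e : s(p i₀, q j₀) = s(p' i₀', q' j₀')) :
    p i₀ = p' i₀' ∧ q j₀ = q' j₀' := by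
  classical
  rcases Sym2.eq_iff.1 e with e | ⟨e1, e2⟩
  · exact e
  · have h1 := h.card_lt hn hP hθ
    have h2 := h'.card_lt hn hP hφ
    rw [← e1, ← e2] at h2
    simp only [orient_swap (p i₀) (q j₀), Left.neg_pos_iff, Left.neg_neg_iff] at h2
    exact absurd h1 (lt_asymm h2)

/-- The chain through the left vertex of a tangent goes on in the same way for all orientations. -/
theorem p_add_eq (hP : GeneralPosition P) (h : TangentOver P θ k p l q i j i₀ j₀ z)
    (h' : TangentOver P φ k' p' l' q' i' j' i₀' j₀' z') (ea : p i₀ = p' i₀')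
    (eb : q j₀ = q' j₀') : ∀ t, i₀ + t ≤ k → i₀' + t ≤ k' → p (i₀ + t) = p' (i₀' + t)
  | 0, _, _ => ea
  | 1, ht, ht' => by
    -- With no common edge yet, the tangent itself supplies the starting direction.
    have a1 := h.hp.halving ht
    have a2 := h.hp.lt _ ht
    have a3 := h.slope_succ_lt
    have a4 := fun u hu hs => h.gap_p u hu ((WithTop.coe_lt_coe.2 hs).trans h.slope_lt_inSlope)
    have b0 := h'.lt
    have b1 := h'.hp.halving ht'
    have b2 := h'.hp.lt _ ht'
    have b3 := h'.slope_succ_lt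
    have b4 := fun u hu hs => h'.gap_p u hu ((WithTop.coe_lt_coe.2 hs).trans h'.slope_lt_inSlope)
    rw [← ea] at b1 b2
    rw [← ea, ← eb] at b0 b3 b4
    exact eq_of_next_right hP a1 b1 h.lt b0 a2 b2 a3 b3 a4 b4
  | t + 2, ht, ht' =>
    h.hp.succ_eq hP h'.hp (i := i₀ + t) (j := i₀' + t) (by omega) (by omega)
      (p_add_eq hP h h' ea eb t (by omega) (by omega))
      (p_add_eq hP h h' ea eb (t + 1) (by omega) (by omega))

/-- The chain through the right vertex of a tangent arrives there in the same way for all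
orientations. -/
theorem q_sub_eq (hP : GeneralPosition P) (h : TangentOver P θ k p l q i j i₀ j₀ z)
    (h' : TangentOver P φ k' p' l' q' i' j' i₀' j₀' z') (ea : p i₀ = p' i₀')
    (eb : q j₀ = q' j₀') : ∀ t r r', r + t = j₀ → r' + t = j₀' → q r = q' r'
  | 0, r, r', hr, hr' => by
    obtain rfl : r = j₀ := hr
    obtain rfl : r' = j₀' := hr'
    exact eb
  | 1, r, r', hr, hr' => by
    subst hr hr'
    have a1 := (h.hq.halving h.hj₀).symm
    have a2 := h.hq.lt r h.hj₀
    have a3 := h.slope_lt_pred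
    have a4 := h.gap_q
    have b0 := h'.lt
    have b1 := (h'.hq.halving h'.hj₀).symm
    have b2 := h'.hq.lt r' h'.hj₀
    have b3 := h'.slope_lt_pred
    have b4 := h'.gap_q
    rw [← eb] at b1 b2
    rw [← ea, ← eb] at b0 b3 b4
    exact eq_of_next_left hP a1 b1 h.lt b0 a2 b2 a3 b3 a4 b4
  | t + 2, r, r', hr, hr' => by
    have := h.hj₀
    have := h'.hj₀
    exact h.hq.pred_eq hP h'.hq (by omega) (by omega)
      (q_sub_eq hP h h' ea eb (t + 1) (r + 1) (r' + 1) (by omega) (by omega))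
      (q_sub_eq hP h h' ea eb t (r + 2) (r' + 2) (by omega) (by omega))

/-- Beyond the left tangent vertex all edges are less steep than the tangent, so the chain moves
away from it. Measured by `orient`, this can be compared across orientations. -/
theorem orient_p_succ_lt (h : TangentOver P θ k p l q i j i₀ j₀ z) {t : ℕ} (ht : i₀ ≤ t)
    (htk : t < k) : orient (p i₀) (q j₀) (p (t + 1)) < orient (p i₀) (q j₀) (p t) := by
  have h1 : slopeAt θ (p t) (p (t + 1)) < slopeAt θ (p i₀) (q j₀) := by
    rcases ht.eq_or_lt with rfl | ht
    · exact h.slope_succ_lt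
    · exact (h.hp.slope_lt ht htk).trans h.slope_succ_lt
  have h2 := (slopeAt_lt_iff h.lt (h.hp.lt t htk)).1 h1
  unfold cross at h2
  unfold orient
  linarith

theorem orient_p_le (h : TangentOver P θ k p l q i j i₀ j₀ z) {s t : ℕ} (hs : i₀ ≤ s)
    (hst : s ≤ t) (ht : t ≤ k) : orient (p i₀) (q j₀) (p t) ≤ orient (p i₀) (q j₀) (p s) := by
  induction t, hst using Nat.le_induction with
  | base => exact le_rfl
  | succ t hst ih => exact (h.orient_p_succ_lt (hs.trans hst) ht).le.trans (ih (by omega))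

theorem orient_q_lt_succ (h : TangentOver P θ k p l q i j i₀ j₀ z) {t : ℕ} (ht : t < j₀) :
    orient (p i₀) (q j₀) (q t) < orient (p i₀) (q j₀) (q (t + 1)) := by
  obtain ⟨r, rfl⟩ : ∃ r, j₀ = r + 1 := ⟨j₀ - 1, by omega⟩
  have htl := ht.trans_le h.hj₀
  have h1 : slopeAt θ (p i₀) (q (r + 1)) < slopeAt θ (q t) (q (t + 1)) := by
    rcases (Nat.lt_succ_iff.1 ht).eq_or_lt with rfl | ht
    · exact h.slope_lt_pred
    · exact h.slope_lt_pred.trans (h.hq.slope_lt ht h.hj₀)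
  have h2 := (slopeAt_lt_iff (h.hq.lt t htl) h.lt).1 h1
  unfold cross at h2
  unfold orient
  linarith

theorem orient_q_le (h : TangentOver P θ k p l q i j i₀ j₀ z) {s t : ℕ} (hst : s ≤ t)
    (ht : t ≤ j₀) : orient (p i₀) (q j₀) (q s) ≤ orient (p i₀) (q j₀) (q t) := by
  induction t, hst using Nat.le_induction with
  | base => exact le_rfl
  | succ t hst ih => exact (ih (by omega)).trans (h.orient_q_lt_succ ht).le

/-- For two orientations with the same tangent, it cannot be that the crossing edge of the left
chain comes earlier for `θ` and the crossing edge of the right chain comes earlier for `φ`. -/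
theorem not_interleaved (hP : GeneralPosition P) (h : TangentOver P θ k p l q i j i₀ j₀ z)
    (h' : TangentOver P φ k' p' l' q' i' j' i₀' j₀' z') (ea : p i₀ = p' i₀')
    (eb : q j₀ = q' j₀') (ht : i - i₀ < i' - i₀') : ¬ j₀' - j' < j₀ - j := by
  intro hs
  have c1 := h.i₀_le
  have c2 := h'.i₀_le
  have c3 := h.lt_j₀
  have c4 := h'.lt_j₀
  have c5 := h.hi
  have c6 := h'.hi
  have e1 : p (i + 1) = p' (i₀' + (i - i₀ + 1)) := by
    rw [← h.p_add_eq hP h' ea eb _ (by omega) (by omega)]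
    congr 1; omega
  have e2 : q (j₀ - (j₀' - j')) = q' j' :=
    h.q_sub_eq hP h' ea eb (j₀' - j') _ _ (by omega) (by omega)
  -- Along the left chain `z` comes before `p (i + 1)` and `z'` after it, so `z'` is further below
  -- the tangent. The right chain likewise puts `z` further below.
  have a1 := (orient_mem_openSegment h.zp (h.orient_p_succ_lt c1 h.hi)).1
  have a2 := h'.orient_p_le (s := i₀' + (i - i₀ + 1)) (t := i') (by omega) (by omega) c6.le
  have a3 := (orient_mem_openSegment h'.zp (h'.orient_p_succ_lt c2 h'.hi)).2
  have zq := h.zq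
  have zq' := h'.zq
  rw [openSegment_symm] at zq zq'
  have b1 := (orient_mem_openSegment zq' (h'.orient_q_lt_succ c4)).1
  have b2 := h.orient_q_le (s := j + 1) (t := j₀ - (j₀' - j')) (by omega) (by omega)
  have b3 := (orient_mem_openSegment zq (h.orient_q_lt_succ c3)).2
  rw [← ea, ← eb] at a2 a3 b1
  rw [e1] at a1
  rw [e2] at b2
  linarith

/-- For two orientations with the same tangent, if the crossing edges for `θ` come no later than
those for `φ`, then they are the same. -/
theorem edges_eq_of_le (hP : GeneralPosition P) (h : TangentOver P θ k p l q i j i₀ j₀ z)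
    (h' : TangentOver P φ k' p' l' q' i' j' i₀' j₀' z') (ea : p i₀ = p' i₀')
    (eb : q j₀ = q' j₀') (ht : i - i₀ ≤ i' - i₀') (hs : j₀ - j ≤ j₀' - j') :
    s(s(p i, p (i + 1)), s(q j, q (j + 1))) =
      s(s(p' i', p' (i' + 1)), s(q' j', q' (j' + 1))) := by
  have c1 := h.i₀_le
  have c2 := h'.i₀_le
  have c3 := h.lt_j₀
  have c4 := h'.lt_j₀
  have c5 := h.hi
  have c6 := h'.hi
  have c7 := h'.hj₀
  have e1 : p i = p' (i₀' + (i - i₀)) := by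
    rw [← h.p_add_eq hP h' ea eb _ (by omega) (by omega)]
    congr 1; omega
  have e2 : p (i + 1) = p' (i₀' + (i - i₀) + 1) := by
    rw [add_assoc, ← h.p_add_eq hP h' ea eb _ (by omega) (by omega)]
    congr 1; omega
  have e3 : q j = q' (j₀' - (j₀ - j)) :=
    h.q_sub_eq hP h' ea eb (j₀ - j) _ _ (by omega) (by omega)
  have e4 : q (j + 1) = q' (j₀' - (j₀ - j) + 1) :=
    h.q_sub_eq hP h' ea eb (j₀ - (j + 1)) _ _ (by omega) (by omega)
  have zp := h.zp
  have zq := h.zq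
  have ne := h.ne
  rw [e1, e2, e3, e4] at ne
  rw [e1, e2] at zp
  rw [e3, e4] at zq
  rw [e1, e2, e3, e4]
  have hi : i₀' + (i - i₀) < k' := by omega
  have hj : j₀' - (j₀ - j) < l' := by omega
  -- The edges crossing at `z` lie on the chains for `φ` as well, so `z` is a second crossing under
  -- the same tangent in one orientation.
  have H : TangentOver P φ k' p' l' q' (i₀' + (i - i₀)) (j₀' - (j₀ - j)) i₀' j₀' z :=
    ⟨h'.hp, h'.hq, hi, hj, h'.hi₀, h'.hj₀, ne, zp, zq,
      (h'.hp.xc_le (by omega) hi.le).trans_lt (xc_lt_of_mem_openSegment zp (h'.hp.lt _ hi)).1,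
      (xc_lt_of_mem_openSegment zq (h'.hq.lt _ hj)).2.trans_le (h'.hq.xc_le (by omega) h'.hj₀),
      h'.below_p, h'.below_q⟩
  obtain ⟨f1, f2⟩ := H.index_eq h'
  rw [f1, f2]

theorem edges_eq (hP : GeneralPosition P) (h : TangentOver P θ k p l q i j i₀ j₀ z)
    (h' : TangentOver P φ k' p' l' q' i' j' i₀' j₀' z') (ea : p i₀ = p' i₀')
    (eb : q j₀ = q' j₀') :
    s(s(p i, p (i + 1)), s(q j, q (j + 1))) =
      s(s(p' i', p' (i' + 1)), s(q' j', q' (j' + 1))) := by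
  rcases le_or_gt (i - i₀) (i' - i₀') with ht | ht <;>
    rcases le_or_gt (j₀ - j) (j₀' - j') with hs | hs
  · exact h.edges_eq_of_le hP h' ea eb ht hs
  · rcases ht.lt_or_eq with ht | ht
    · exact absurd hs (h.not_interleaved hP h' ea eb ht)
    · exact (h'.edges_eq_of_le hP h ea.symm eb.symm ht.ge hs.le).symm
  · rcases hs.lt_or_eq with hs | hs
    · exact absurd hs (h'.not_interleaved hP h ea.symm eb.symm ht)
    · exact (h'.edges_eq_of_le hP h ea.symm eb.symm ht.le hs.ge).symm
  · exact (h'.edges_eq_of_le hP h ea.symm eb.symm ht.le hs.le).symm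

end TangentOver

/-- A pair of vertices is charged to at most one crossing, over all orientations. -/
theorem IsCharged.crossing_eq {P : Finset Plane} {θ φ : ℝ} (hn : Even P.card)
    (hP : GeneralPosition P) (hθ : IsOrientation P θ) (hφ : IsOrientation P φ)
    {C C' : Sym2 (Sym2 Plane)} (hC : IsCrossing P C) (hC' : IsCrossing P C') {r : Sym2 Plane}
    (h : IsCharged P θ C r) (h' : IsCharged P φ C' r) : C = C' := by
  obtain ⟨k, p, l, q, i, j, i₀, j₀, z, H, rfl, rfl⟩ := h.exists_tangentOver hn hP hθ hC
  obtain ⟨k', p', l', q', i', j', i₀', j₀', z', H', rfl, e⟩ :=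
    h'.exists_tangentOver hn hP hφ hC'
  obtain ⟨ea, eb⟩ := H.eq_of_pair_eq hn hP hθ hφ H' e
  exact H.edges_eq hP H' ea eb

theorem IsCrossing.isCharged_chargedPair {P : Finset Plane} {θ : ℝ} (hn : Even P.card)
    (hP : GeneralPosition P) (hθ : IsOrientation P θ) {C : Sym2 (Sym2 Plane)}
    (hC : IsCrossing P C) : IsCharged P θ C (chargedPair P C θ) :=
  Classical.epsilon_spec (hC.exists_isCharged hn hP hθ)

end HalvingLines

theorem mainTheorem2 (P : Finset HalvingLines.Plane) (hn : Even P.card)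
    (hP : HalvingLines.GeneralPosition P) :
    (∀ C : Sym2 (Sym2 HalvingLines.Plane), HalvingLines.IsCrossing P C →
      ∀ θ : ℝ, HalvingLines.IsOrientation P θ →
        ∃! p : Sym2 HalvingLines.Plane, HalvingLines.IsCharged P θ C p) ∧
    (∀ C₁ C₂ : Sym2 (Sym2 HalvingLines.Plane),
      HalvingLines.IsCrossing P C₁ → HalvingLines.IsCrossing P C₂ → C₁ ≠ C₂ →
      ∀ θ φ : ℝ, HalvingLines.IsOrientation P θ → HalvingLines.IsOrientation P φ →
        HalvingLines.chargedPair P C₁ θ ≠ HalvingLines.chargedPair P C₂ φ) := by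
  refine ⟨fun C hC θ hθ => ?_, fun C₁ C₂ h₁ h₂ hne θ φ hθ hφ he => hne ?_⟩
  · obtain ⟨r, hr⟩ := hC.exists_isCharged hn hP hθ
    exact ⟨r, hr, fun r' hr' => hr'.unique hn hP hθ hC hr⟩
  · have c₂ := h₂.isCharged_chargedPair hn hP hφ
    rw [← he] at c₂
    exact (h₁.isCharged_chargedPair hn hP hθ).crossing_eq hn hP hθ hφ h₁ h₂ c₂
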